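/- **Setting.** Let $d\ge 1$, let $(\Omega,\mathcal F,\mathbb P)$ be a probability space, and let $(\mathbb R^d,+)$ act on $\Omega$ by measure preserving bijections $\tau_x$, $x\in\mathbb R^d$, such that $(x,\omega)\mapsto\tau_x\omega$ is product measurable (ergodicity is not assumed). For a function $f$ on $\Omega$ write $f_\omega(x):=f(\tau_x\omega)$. A *potential* is a function $V\in L^1=L^1(\Omega,\mathcal F,\mathbb P)$ with $V\ge 0$. A measurable function $f:\Omega\to\mathbb R$ has weak partial derivative $\partial_i f=g$ if $g:\Omega\to\mathbb R$ is measurable and, for $\mathbb P$-a.e. $\omega$, $g_\omega$ is the weak $i$-th partial derivative of $f_\omega\in L^1_{\rm loc}(\mathbb R^d)$; $g$ is unique up to $\mathbb P$-null sets. If every $f_\omega$ is smooth, $D^nf(\omega):=D^nf_\omega(0)$; in this case the weak and classical first derivatives agree $\mathbb P$-a.s. Let $\nabla f=(\partial_1f,\dots,\partial_df)$ and $\|f\|_\nabla:=\|f\|_2+\sum_{i=1}^d\|\partial_if\|_2$. Define - $\mathbb D_{\rm w}$: the measurable $f\in L^2$ having all weak partial derivatives $\partial_if\in L^2$, $1\le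 i\le d$; - $\mathbb D_{\rm s}:=\{f\in\mathbb D_{\rm w}: f_\omega\in C^\infty(\mathbb R^d)\ \forall\omega\in\Omega,\ \sup_\Omega|D^nf|<\infty\ \forall n\ge 0\}$; - $\mathbb F_{\rm w}:=\{f\in\mathbb D_{\rm w}:\mathbb E f=1,\ \exists c>0:\ f>c\ \mathbb P\text{-a.s.},\ \|f\|_\infty<\infty,\ \|\nabla f\|_\infty<\infty\}$; - $\mathbb F_{\rm s}:=\{f\in\mathbb D_{\rm s}:\mathbb E f=1,\ \exists c>0:\ f>c \text{ on } \Omega\}$; - $\Phi^{\rm s}_y:=\{\phi\in(\mathbb D_{\rm s})^d:\nabla\cdot\phi=0\text{ on }\Omega,\ \mathbb E\phi=y\}$ for $y\in\mathbb R^d$; - $\mathfrak D$: the family of all $\mathbb D\subset\mathbb D_{\rm w}$ that are dense in $\mathbb D_{\rm w}$ with respect to $\|\cdot\|_\nabla$; - $\mathfrak F$: the family of all $\mathbb F\subset\mathbb F_{\rm w}$ such that for each $f\in\mathbb F_{\rm w}$ there are $(f_n)_n\subset\mathbb F$ and $c>0$ with $\|f_n-f\|_\nabla\to0$ and $\inf_nf_n>c$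 $\mathbb P$-a.s. For $f\in\mathbb F_{\rm w}$, $b\in(L^2)^d$ (in particular for a constant vector $b$) and $\mathbb D\in\mathfrak D$ let $$K(f):=\mathbb E\Big[\frac{|\nabla f|^2}{8f}+Vf\Big],\qquad H(b,f):=\inf_{w\in\mathbb D}\mathbb E\big[|b-\nabla w|^2f\big],$$ and let $$\Gamma_V(y):=2\inf_{f\in\mathbb F_{\rm s}}\Big[\Big(\int\frac{|\nabla f|^2}{8f}+Vf\,d\mathbb P\Big)\Big(\inf_{\phi\in\Phi^{\rm s}_y}\int\frac{|\phi|^2}{2f}\,d\mathbb P\Big)\Big]^{1/2}.$$ **Proposition.** Let $V$ be a potential. For every $y\in\mathbb R^d$ and every $\mathbb D\in\mathfrak D$ (used in the definition of $H$), $$\Gamma_V(y)=\inf_{f\in\mathbb F_{\rm s}}\ \sup_{\eta\in S^{d-1}}\Big[2K(f)\frac{\langle y,\eta\rangle^2}{H(\eta,f)}\Big]^{1/2}.$$ If additionally $V\in L^2$, then for every $\mathbb F\in\mathfrak F$ also $$\Gamma_V(y)=\inf_{f\in\mathbb F}\ \sup_{\eta\in S^{d-1}}\Big[2K(f)\frac{\langle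 y,\eta\rangle^2}{H(\eta,f)}\Big]^{1/2}.$$ -/

import Mathlib

open MeasureTheory Filter Topology
open scoped ENNReal RealInnerProductSpace

noncomputable section

namespace StationaryPotential

/-- Euclidean space of dimension `d`. -/
abbrev Space (d : ℕ) : Type := EuclideanSpace ℝ (Fin d)

/-- The `i`-th unit vector in coordinate direction. -/
abbrev unitVec {d : ℕ} (i : Fin d) : Space d := EuclideanSpace.single i (1 : ℝ)

section

variable {Ω : Type*} [MeasurableSpace Ω] {d : ℕ} [AddAction (Space d) Ω] (P : Measure Ω)

variable (d) in
/-- The realisation `x ↦ f (τ_x ω)` of a function `f` on `Ω`; the shift `τ_x ω` is `x +ᵥ ω`. -/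
def realisation {β : Type*} (f : Ω → β) (ω : Ω) : Space d → β := fun x => f (x +ᵥ ω)

/-- A potential: a non-negative (measurable) integrable function on `Ω`. -/
structure IsPotential (V : Ω → ℝ) : Prop where
  measurable : Measurable V
  integrable : Integrable V P
  nonneg : ∀ ω, 0 ≤ V ω

/-! ### Weak derivatives on `Ω` -/

/-- `v` is the weak partial derivative in direction `i` of the locally integrable function `u`
on Euclidean space. -/
def IsEuclideanWeakPartial {d : ℕ} (i : Fin d) (u v : Space d → ℝ) : Prop :=
  LocallyIntegrable u volume ∧ LocallyIntegrable v volume ∧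
    ∀ φ : Space d → ℝ, ContDiff ℝ (⊤ : ℕ∞) φ → HasCompactSupport φ →
      ∫ x, u x * fderiv ℝ φ x (unitVec i) = -∫ x, v x * φ x

/-- `g` is a weak partial derivative of `f` in direction `i` on `Ω`: `g` is measurable and almost
surely the realisation of `g` is the weak partial derivative of the realisation of `f`. -/
def IsWeakPartial (i : Fin d) (f g : Ω → ℝ) : Prop :=
  Measurable g ∧
    ∀ᵐ ω ∂P, IsEuclideanWeakPartial i (realisation d f ω) (realisation d g ω)

open Classical in
/-- The weak partial derivative `∂_i f` on `Ω`, which is determined up to almost sure equality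
(and is `0` by convention if it does not exist). -/
def weakPartial (i : Fin d) (f : Ω → ℝ) : Ω → ℝ :=
  if h : ∃ g, IsWeakPartial P i f g then h.choose else 0

variable (d) in
/-- The weak gradient `∇ f` on `Ω`. -/
def weakGrad (f : Ω → ℝ) (ω : Ω) : Space d :=
  WithLp.toLp 2 fun i => weakPartial P i f ω

/-- The domain of `∂_i` in `L²`. -/
def domPartial (i : Fin d) : Set (Ω → ℝ) :=
  {f | Measurable f ∧ MemLp f 2 P ∧ (∃ g, IsWeakPartial P i f g) ∧ MemLp (weakPartial P i f) 2 P}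

variable (d) in
/-- The norm `‖f‖_∇ = ‖f‖₂ + ∑ i, ‖∂_i f‖₂`. -/
def nablaNorm (f : Ω → ℝ) : ℝ≥0∞ :=
  eLpNorm f 2 P + ∑ i : Fin d, eLpNorm (weakPartial P i f) 2 P

/-! ### Classical derivatives on `Ω` -/

variable (d) in
/-- The classical gradient at `ω`, i.e. the gradient at `0` of the realisation. -/
def classicalGrad (f : Ω → ℝ) (ω : Ω) : Space d := gradient (realisation d f ω) 0

/-- The classical divergence at `ω` of a vector field on `Ω`. -/
def classicalDiv (φ : Ω → Space d) (ω : Ω) : ℝ :=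
  ∑ i : Fin d, fderiv ℝ (realisation d (fun ω' => φ ω' i) ω) 0 (unitVec i)

variable (d) in
/-- Every realisation of `f` is smooth, and all derivatives (including order zero) are bounded
uniformly on `Ω`. -/
def IsSmoothBounded (f : Ω → ℝ) : Prop :=
  (∀ ω, ContDiff ℝ (⊤ : ℕ∞) (realisation d f ω)) ∧
    ∀ n : ℕ, ∃ C : ℝ, ∀ ω, ‖iteratedFDeriv ℝ n (realisation d f ω) 0‖ ≤ C

/-! ### Function spaces -/

variable (d) in
/-- The space `𝔻_w` of weakly differentiable test functions. -/
def Dw : Set (Ω → ℝ) := ⋂ i : Fin d, domPartial P i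

variable (d) in
/-- The space `𝔻_s` of strongly differentiable test functions. -/
def Ds : Set (Ω → ℝ) := {f | f ∈ Dw d P ∧ IsSmoothBounded d f}

variable (d) in
/-- The space `𝔽_w` of weakly differentiable probability densities. -/
def Fw : Set (Ω → ℝ) :=
  {f | f ∈ Dw d P ∧ ∫ ω, f ω ∂P = 1 ∧ (∃ c : ℝ, 0 < c ∧ ∀ᵐ ω ∂P, c < f ω) ∧
    eLpNorm f ∞ P < ∞ ∧ eLpNorm (weakGrad d P f) ∞ P < ∞}

variable (d) in
/-- The space `𝔽_s` of strongly differentiable probability densities. -/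
def Fs : Set (Ω → ℝ) :=
  {f | f ∈ Ds d P ∧ ∫ ω, f ω ∂P = 1 ∧ ∃ c : ℝ, 0 < c ∧ ∀ ω, c < f ω}

/-- The space `Φ_y^s` of strongly differentiable divergence-free vector fields with mean `y`. -/
def PhiS (y : Space d) : Set (Ω → Space d) :=
  {φ | (∀ i : Fin d, (fun ω => φ ω i) ∈ Ds d P) ∧ (∀ ω, classicalDiv φ ω = 0) ∧
    ∫ ω, φ ω ∂P = y}

variable (d) in
/-- The family `𝔇` of subsets of `𝔻_w` which are dense with respect to `‖·‖_∇`. -/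
def TestClass : Set (Set (Ω → ℝ)) :=
  {D | D ⊆ Dw d P ∧ ∀ f ∈ Dw d P, ∀ ε : ℝ≥0∞, 0 < ε → ∃ g ∈ D, nablaNorm d P (g - f) < ε}

variable (d) in
/-- The family `𝔉` of subsets of `𝔽_w` from which every `f ∈ 𝔽_w` is the `‖·‖_∇`-limit of a
sequence that is almost surely bounded below by a common positive constant. -/
def DensityClass : Set (Set (Ω → ℝ)) :=
  {F | F ⊆ Fw d P ∧ ∀ f ∈ Fw d P, ∃ (u : ℕ → Ω → ℝ) (c : ℝ), (∀ n, u n ∈ F) ∧ 0 < c ∧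
    Tendsto (fun n => nablaNorm d P (u n - f)) atTop (𝓝 0) ∧ ∀ᵐ ω ∂P, ∀ n, c < u n ω}

/-! ### The functionals -/

/-- `H(b, f) = inf_{w ∈ D} 𝔼[|b - ∇w|² f]`, formed with the space `D` of test functions. -/
def H (D : Set (Ω → ℝ)) (b : Ω → Space d) (f : Ω → ℝ) : ℝ :=
  ⨅ w : D, ∫ ω, ‖b ω - weakGrad d P w ω‖ ^ 2 * f ω ∂P

variable (d) in
/-- `K(f) = 𝔼[|∇f|² / (8 f) + V f]`. -/
def K (V f : Ω → ℝ) : ℝ :=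
  ∫ ω, (‖weakGrad d P f ω‖ ^ 2 / (8 * f ω) + V ω * f ω) ∂P

/-- The variational expression
`Γ_V(y) = 2 inf_{f ∈ 𝔽_s} [(∫ |∇f|² / (8 f) + V f dP) (inf_{φ ∈ Φ_y^s} ∫ |φ|² / (2 f) dP)]^{1/2}`,
with classical derivatives. -/
def Gam (V : Ω → ℝ) (y : Space d) : ℝ :=
  2 * ⨅ f : Fs (Ω := Ω) d P,
    √((∫ ω, (‖classicalGrad d f.1 ω‖ ^ 2 / (8 * f.1 ω) + V ω * f.1 ω) ∂P) *
      ⨅ φ : PhiS (Ω := Ω) P y, ∫ ω, ‖φ.1 ω‖ ^ 2 / (2 * f.1 ω) ∂P)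

/-- `inf_{f ∈ F} sup_{η ∈ S^{d-1}} [2 K(f) ⟨y, η⟩² / H(η, f)]^{1/2}`, where `H` is formed with the
space `D` of test functions. -/
def infSup (V : Ω → ℝ) (D F : Set (Ω → ℝ)) (y : Space d) : ℝ :=
  ⨅ f : F, ⨆ η : Metric.sphere (0 : Space d) 1,
    √(2 * K d P V f * (⟪y, (η : Space d)⟫ ^ 2 / H P D (fun _ => (η : Space d)) f))

end

end StationaryPotential

end

noncomputable section

set_option linter.unusedSectionVars false

namespace StationaryPotential

/-! ### Shifts of `Ω` and Fubini along orbits. -/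

section Shift

variable {Ω : Type*} [MeasurableSpace Ω] {d : ℕ} [AddAction (Space d) Ω]
  [MeasurableVAdd₂ (Space d) Ω] {P : Measure Ω} [IsProbabilityMeasure P]
  [VAddInvariantMeasure (Space d) Ω P]

/-! For a fixed density `f` the identity is a duality between gradients and divergence-free fields
in `L²`. Let `S` be the space of fields `√f ∇w`. Then `H(η, f)` is the squared distance from `√f η`
to `S`. A smooth divergence-free `φ` with mean `y` gives `φ/√f ∈ Sᗮ`, whose pairing with `√f η` is
`⟪y, η⟫`. Cauchy–Schwarz yields `⟪y, η⟫² ≤ E[|φ|²/f] H(η, f)` (`sq_inner_le`). Equality holds at an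
optimal `η`: project `√f b` onto `Sᗮ` to get `r`, with `b` chosen so that `√f r` has mean `y`.
Choosing `b` is a finite-dimensional linear system (`exists_dual_minimiser`), and the direction of
`b` attains the supremum (`exists_minEnergy_le_div_H`). The numerical factors then agree, since `2
√(K · m/2) = √(2 K m)`.

The optimal field `√f r` is only square integrable and orthogonal to gradients, while the infimum
runs over smooth bounded fields. The bridge is a Helmholtz-type density statement
(`mem_closure_divFreeLp`): an `L²` field `ψ` orthogonal both to gradients and to smooth
divergence-free fields vanishes (`ae_eq_zero_of_orthogonal`). Formally such a `ψ` has no divergence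
and no curl, so its mollified components are harmonic. Stationarity and an integration by parts over
`Ω` make their gradients zero, so the components are constant along orbits. Without ergodicity these
invariant functions need not be constant on `Ω`; however, a bounded invariant function times a unit
vector is itself a smooth divergence-free field, and testing against it finishes the argument.

For `V ∈ L²`, `K` is continuous along the approximations allowed in `DensityClass`, and so is the
energy of each fixed bounded field. Hence every admissible class has the same infimum as `Fw`
(`iInf_eq_iInf_Fw`). Mollification shows that `Fs` is itself admissible (`Fs_mem_DensityClass`), and
both sides are compared through `Fw`. -/

lemma measurable_shift {X : Type*} [MeasurableSpace X] {β : Type*} [MeasurableSpace β]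
    {s : X → Space d} (hs : Measurable s) {u : Ω → β} (hu : Measurable u) :
    Measurable fun z : X × Ω => u (s z.1 +ᵥ z.2) :=
  hu.comp ((hs.comp measurable_fst).vadd measurable_snd)

lemma measurable_realisation {β : Type*} [MeasurableSpace β] {u : Ω → β} (hu : Measurable u)
    (ω : Ω) : Measurable (realisation d u ω) :=
  hu.comp (measurable_id.vadd measurable_const)

lemma realisation_vadd {β : Type*} (u : Ω → β) (x z : Space d) (ω : Ω) :
    realisation d u (x +ᵥ ω) z = realisation d u ω (z + x) := by
  simp [realisation, vadd_vadd]

variable (P) in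
-- Each fibre map preserves `P`, so the shear preserves the product measure. This is how statements
-- on `Ω` and statements along orbits are exchanged.
lemma measurePreserving_shear {X : Type*} [MeasurableSpace X] (μ : Measure X) [SFinite μ]
    {s : X → Space d} (hs : Measurable s) :
    MeasurePreserving (fun z : X × Ω => (z.1, s z.1 +ᵥ z.2)) (μ.prod P) (μ.prod P) :=
  (MeasurePreserving.id μ).skew_product (measurable_shift hs measurable_id)
    (ae_of_all _ fun x => (measurePreserving_vadd (s x) P).map_eq)

/-- An almost sure property holds almost surely along almost every shift. -/
lemma ae_ae_vadd {p : Ω → Prop} (h : ∀ᵐ ω ∂P, p ω) :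
    ∀ᵐ ω ∂P, ∀ᵐ x : Space d, p (x +ᵥ ω) := by
  have h1 : ∀ᵐ z ∂((volume : Measure (Space d)).prod P), p (z.1 +ᵥ z.2) :=
    ((Measure.quasiMeasurePreserving_snd).comp
      (measurePreserving_shear P volume measurable_id).quasiMeasurePreserving).ae h
  have h2 : ∀ᵐ z ∂(P.prod (volume : Measure (Space d))), p (z.2 +ᵥ z.1) :=
    (Measure.measurePreserving_swap).quasiMeasurePreserving.ae h1
  exact Measure.ae_ae_of_ae_prod h2

/-- A property that holds along almost every shift holds almost surely. -/
lemma ae_of_ae_ae_vadd {p : Ω → Prop} (hp : MeasurableSet {ω | p ω})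
    (h : ∀ᵐ ω ∂P, ∀ᵐ x : Space d, p (x +ᵥ ω)) : ∀ᵐ ω ∂P, p ω := by
  have hm : MeasurableSet {z : Ω × Space d | p (z.2 +ᵥ z.1)} :=
    (measurable_snd.vadd measurable_fst) hp
  rw [Measure.ae_ae_comm (p := fun ω x => p (x +ᵥ ω)) hm] at h
  obtain ⟨x, hx⟩ := h.exists
  rw [← (measurePreserving_vadd x P).map_eq,
    ae_map_iff (measurePreserving_vadd x P).measurable.aemeasurable hp]
  exact hx

lemma integrable_mul_shift {X : Type*} [MeasurableSpace X] {μ : Measure X} [SFinite μ]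
    {s : X → Space d} (hs : Measurable s) {θ : X → ℝ} (hθ : Integrable θ μ)
    {u : Ω → ℝ} (hu : Integrable u P) :
    Integrable (fun z : X × Ω => θ z.1 * u (s z.1 +ᵥ z.2)) (μ.prod P) :=
  (measurePreserving_shear P μ hs).integrable_comp_of_integrable (hθ.mul_prod hu)

/-- The integral of a function over the product, with a weight in the spatial variable. -/
lemma integral_integral_mul_vadd {X : Type*} [MeasurableSpace X] {μ : Measure X} [SFinite μ]
    {s : X → Space d} (hs : Measurable s) {θ : X → ℝ} (hθ : Integrable θ μ)
    {u : Ω → ℝ} (hu : Integrable u P) :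
    ∫ ω, ∫ x, θ x * u (s x +ᵥ ω) ∂μ ∂P = (∫ x, θ x ∂μ) * ∫ ω, u ω ∂P := by
  rw [integral_integral_swap]
  · simp_rw [integral_const_mul, integral_vadd_eq_self, integral_mul_const]
  · exact (integrable_mul_shift hs hθ hu).swap

/-- Fubini on each ball of integer radius; countably many balls cover the space, so one null set
suffices. -/
lemma ae_locallyIntegrable {u : Ω → ℝ} (hu : Integrable u P) :
    ∀ᵐ ω ∂P, LocallyIntegrable (realisation d u ω) volume := by
  have h : ∀ n : ℕ, ∀ᵐ ω ∂P,
      IntegrableOn (realisation d u ω) (Metric.ball (0 : Space d) n) volume := by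
    intro n
    have : IsFiniteMeasure (volume.restrict (Metric.ball (0 : Space d) n)) :=
      ⟨by simpa using measure_ball_lt_top⟩
    have := integrable_mul_shift (P := P) (μ := volume.restrict (Metric.ball (0 : Space d) n))
      measurable_id (integrable_const (1 : ℝ)) hu
    filter_upwards [this.prod_left_ae] with ω hω
    simp only [one_mul, id_eq] at hω
    exact hω
  rw [← ae_all_iff] at h
  filter_upwards [h] with ω hω x
  obtain ⟨n, hn⟩ := exists_nat_gt ‖x‖
  exact ⟨_, Metric.isOpen_ball.mem_nhds (by simpa using hn), hω n⟩

lemma locallyIntegrable_of_bounded {u : Ω → ℝ} (hu : Measurable u) {C : ℝ}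
    (hC : ∀ ω, |u ω| ≤ C) (ω : Ω) : LocallyIntegrable (realisation d u ω) volume := by
  have : MemLp (realisation d u ω) ∞ volume :=
    memLp_top_of_bound (measurable_realisation hu ω).aestronglyMeasurable C
      (ae_of_all _ fun x => hC _)
  exact this.locallyIntegrable le_top

end Shift

/-! ### Weak derivatives -/

section Weak

variable {Ω : Type*} [MeasurableSpace Ω] {d : ℕ} [AddAction (Space d) Ω]
  [MeasurableVAdd₂ (Space d) Ω] {P : Measure Ω} [IsProbabilityMeasure P]
  [VAddInvariantMeasure (Space d) Ω P]

lemma LocallyIntegrable.integrable_mul_test {u φ : Space d → ℝ}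
    (hu : LocallyIntegrable u volume) (hφ : Continuous φ) (hc : HasCompactSupport φ) :
    Integrable (fun x => u x * φ x) volume := by
  simpa [mul_comm] using hu.integrable_smul_left_of_hasCompactSupport hφ hc

lemma IsEuclideanWeakPartial.ae_eq {i : Fin d} {u v v' : Space d → ℝ}
    (h : IsEuclideanWeakPartial i u v) (h' : IsEuclideanWeakPartial i u v') : v =ᵐ[volume] v' := by
  have := ae_eq_zero_of_integral_contDiff_smul_eq_zero (h.2.1.sub h'.2.1) (μ := volume) ?_
  · filter_upwards [this] with x hx
    simpa [sub_eq_zero] using hx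
  · intro g hg hc
    have e := (h.2.2 g hg hc).symm.trans (h'.2.2 g hg hc)
    simp only [Pi.sub_apply, smul_eq_mul, mul_sub]
    rw [integral_sub]
    · simp_rw [mul_comm (g _)]
      linarith
    · simpa [mul_comm] using LocallyIntegrable.integrable_mul_test h.2.1 hg.continuous hc
    · simpa [mul_comm] using LocallyIntegrable.integrable_mul_test h'.2.1 hg.continuous hc

/-- Uniqueness holds on almost every orbit by the fundamental lemma of the calculus of variations,
and `ae_of_ae_ae_vadd` brings it back to `Ω`. -/
lemma IsWeakPartial.ae_eq {i : Fin d} {f g g' : Ω → ℝ} (h : IsWeakPartial P i f g)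
    (h' : IsWeakPartial P i f g') : g =ᵐ[P] g' := by
  refine ae_of_ae_ae_vadd (d := d) (measurableSet_eq_fun h.1 h'.1) ?_
  filter_upwards [h.2, h'.2] with ω h1 h2
  exact h1.ae_eq h2

lemma IsWeakPartial.congr {i : Fin d} {f f' g : Ω → ℝ} (h : IsWeakPartial P i f g)
    (e : f =ᵐ[P] f') : IsWeakPartial P i f' g := by
  refine ⟨h.1, ?_⟩
  filter_upwards [h.2, ae_ae_vadd (d := d) e] with ω h1 h2
  have h2 : realisation d f ω =ᵐ[volume] realisation d f' ω := h2
  refine ⟨h1.1.congr h2, h1.2.1, fun φ hφ hc => ?_⟩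
  rw [← h1.2.2 φ hφ hc]
  refine integral_congr_ae ?_
  filter_upwards [h2] with x hx
  rw [hx]

lemma continuous_fderiv_apply_test {φ : Space d → ℝ} (hφ : ContDiff ℝ (⊤ : ℕ∞) φ) (v : Space d) :
    Continuous fun x => fderiv ℝ φ x v :=
  (hφ.continuous_fderiv (by simp)).clm_apply continuous_const

lemma IsWeakPartial.add {i : Fin d} {f f' g g' : Ω → ℝ} (h : IsWeakPartial P i f g)
    (h' : IsWeakPartial P i f' g') : IsWeakPartial P i (f + f') (g + g') := by
  refine ⟨h.1.add h'.1, ?_⟩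
  filter_upwards [h.2, h'.2] with ω h1 h2
  refine ⟨h1.1.add h2.1, h1.2.1.add h2.2.1, fun φ hφ hc => ?_⟩
  have e1 : ∀ x, realisation d (f + f') ω x = realisation d f ω x + realisation d f' ω x :=
    fun x => rfl
  have e2 : ∀ x, realisation d (g + g') ω x = realisation d g ω x + realisation d g' ω x :=
    fun x => rfl
  have hc' : HasCompactSupport fun x => fderiv ℝ φ x (unitVec i) := hc.fderiv_apply ℝ _
  have hk := continuous_fderiv_apply_test hφ (unitVec i)
  simp_rw [e1, e2, add_mul]
  rw [integral_add (LocallyIntegrable.integrable_mul_test h1.1 hk hc')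
      (LocallyIntegrable.integrable_mul_test h2.1 hk hc'),
    integral_add (LocallyIntegrable.integrable_mul_test h1.2.1 hφ.continuous hc)
      (LocallyIntegrable.integrable_mul_test h2.2.1 hφ.continuous hc),
    h1.2.2 φ hφ hc, h2.2.2 φ hφ hc]
  ring

lemma IsWeakPartial.smul {i : Fin d} {f g : Ω → ℝ} (h : IsWeakPartial P i f g) (c : ℝ) :
    IsWeakPartial P i (c • f) (c • g) := by
  refine ⟨h.1.const_smul c, ?_⟩
  filter_upwards [h.2] with ω h1
  refine ⟨h1.1.smul c, h1.2.1.smul c, fun φ hφ hc => ?_⟩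
  have e1 : ∀ x, realisation d (c • f) ω x = c * realisation d f ω x := fun x => rfl
  have e2 : ∀ x, realisation d (c • g) ω x = c * realisation d g ω x := fun x => rfl
  simp_rw [e1, e2, mul_assoc, integral_const_mul, h1.2.2 φ hφ hc]
  ring

lemma isWeakPartial_weakPartial {i : Fin d} {f g : Ω → ℝ} (h : IsWeakPartial P i f g) :
    IsWeakPartial P i f (weakPartial P i f) := by
  have h' : ∃ g, IsWeakPartial P i f g := ⟨g, h⟩
  rw [weakPartial, dif_pos h']
  exact h'.choose_spec

lemma IsWeakPartial.weakPartial_ae_eq {i : Fin d} {f g : Ω → ℝ} (h : IsWeakPartial P i f g) :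
    weakPartial P i f =ᵐ[P] g :=
  (isWeakPartial_weakPartial h).ae_eq h

lemma measurable_weakPartial (i : Fin d) (f : Ω → ℝ) : Measurable (weakPartial P i f) := by
  by_cases h : ∃ g, IsWeakPartial P i f g
  · exact (isWeakPartial_weakPartial h.choose_spec).1
  · rw [weakPartial, dif_neg h]
    exact measurable_zero

/-- `Dw` is an intersection over coordinates, so measurability and square integrability of `f` can
be read off only if some coordinate exists. This is where `1 ≤ d` enters. -/
lemma mem_Dw_iff {f : Ω → ℝ} (hd : 1 ≤ d) : f ∈ Dw d P ↔ Measurable f ∧ MemLp f 2 P ∧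
    ∀ i : Fin d, IsWeakPartial P i f (weakPartial P i f) ∧ MemLp (weakPartial P i f) 2 P := by
  simp only [Dw, Set.mem_iInter, domPartial, Set.mem_ofPred_eq]
  constructor
  · intro h
    refine ⟨(h ⟨0, hd⟩).1, (h ⟨0, hd⟩).2.1, fun i => ⟨?_, (h i).2.2.2⟩⟩
    obtain ⟨g, hg⟩ := (h i).2.2.1
    exact isWeakPartial_weakPartial hg
  · rintro ⟨h1, h2, h3⟩ i
    exact ⟨h1, h2, ⟨_, (h3 i).1⟩, (h3 i).2⟩

lemma mem_Dw_of {f : Ω → ℝ} (hf : Measurable f) (hf2 : MemLp f 2 P) {g : Fin d → Ω → ℝ}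
    (hg : ∀ i, IsWeakPartial P i f (g i)) (hg2 : ∀ i, MemLp (g i) 2 P) : f ∈ Dw d P := by
  simp only [Dw, Set.mem_iInter, domPartial, Set.mem_ofPred_eq]
  exact fun i => ⟨hf, hf2, ⟨_, hg i⟩, (hg2 i).ae_eq (hg i).weakPartial_ae_eq.symm⟩

lemma Dw_add (hd : 1 ≤ d) {f g : Ω → ℝ} (hf : f ∈ Dw d P) (hg : g ∈ Dw d P) :
    f + g ∈ Dw d P := by
  rw [mem_Dw_iff hd] at hf hg
  exact mem_Dw_of (hf.1.add hg.1) (hf.2.1.add hg.2.1)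
    (fun i => (hf.2.2 i).1.add (hg.2.2 i).1) fun i => (hf.2.2 i).2.add (hg.2.2 i).2

lemma Dw_smul (hd : 1 ≤ d) {f : Ω → ℝ} (hf : f ∈ Dw d P) (c : ℝ) : c • f ∈ Dw d P := by
  rw [mem_Dw_iff hd] at hf
  exact mem_Dw_of (hf.1.const_smul c) (hf.2.1.const_smul c)
    (fun i => (hf.2.2 i).1.smul c) fun i => (hf.2.2 i).2.const_smul c

lemma weakGrad_ae_eq {f : Ω → ℝ} {g : Ω → Space d}
    (h : ∀ i, IsWeakPartial P i f fun ω => g ω i) : weakGrad d P f =ᵐ[P] g := by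
  have : ∀ᵐ ω ∂P, ∀ i, weakPartial P i f ω = g ω i :=
    ae_all_iff.2 fun i => (h i).weakPartial_ae_eq
  filter_upwards [this] with ω hω
  ext i
  exact hω i

lemma weakGrad_add (hd : 1 ≤ d) {f g : Ω → ℝ} (hf : f ∈ Dw d P) (hg : g ∈ Dw d P) :
    weakGrad d P (f + g) =ᵐ[P] fun ω => weakGrad d P f ω + weakGrad d P g ω := by
  rw [mem_Dw_iff hd] at hf hg
  exact weakGrad_ae_eq fun i => (hf.2.2 i).1.add (hg.2.2 i).1

lemma weakGrad_smul (hd : 1 ≤ d) {f : Ω → ℝ} (hf : f ∈ Dw d P) (c : ℝ) :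
    weakGrad d P (c • f) =ᵐ[P] fun ω => c • weakGrad d P f ω := by
  rw [mem_Dw_iff hd] at hf
  exact weakGrad_ae_eq fun i => (hf.2.2 i).1.smul c

lemma weakGrad_sub (hd : 1 ≤ d) {f g : Ω → ℝ} (hf : f ∈ Dw d P) (hg : g ∈ Dw d P) :
    weakGrad d P (f - g) =ᵐ[P] fun ω => weakGrad d P f ω - weakGrad d P g ω := by
  have e : f - g = f + (-1 : ℝ) • g := by ext ω; simp [sub_eq_add_neg]
  rw [e]
  filter_upwards [weakGrad_add hd hf (Dw_smul hd hg (-1)), weakGrad_smul hd hg (-1)] with ω h1 h2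
  rw [h1, h2]
  simp [sub_eq_add_neg]

lemma memLp_of_components {p : ℝ≥0∞} {φ : Ω → Space d} (h : ∀ i, MemLp (fun ω => φ ω i) p P) :
    MemLp φ p P := by
  have e : φ = fun ω => ∑ i, (φ ω i) • (unitVec i : Space d) := by
    ext ω j
    simp [Finset.sum_apply, Pi.single_apply]
  rw [e]
  refine memLp_finsetSum _ fun i _ => ?_
  exact (ContinuousLinearMap.toSpanSingleton ℝ (unitVec i : Space d)).comp_memLp' (h i)

lemma memLp_weakGrad (hd : 1 ≤ d) {f : Ω → ℝ} (hf : f ∈ Dw d P) :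
    MemLp (weakGrad d P f) 2 P :=
  memLp_of_components fun i => (((mem_Dw_iff hd).1 hf).2.2 i).2

end Weak

/-! ### Test functions -/

section Test

variable {d : ℕ}

/-- Smooth compactly supported functions. -/
structure IsTest (θ : Space d → ℝ) : Prop where
  smooth : ContDiff ℝ (⊤ : ℕ∞) θ
  compact : HasCompactSupport θ

/-- The `i`-th partial derivative. -/
def pd (i : Fin d) (θ : Space d → ℝ) (x : Space d) : ℝ := fderiv ℝ θ x (unitVec i)

lemma IsTest.continuous {θ : Space d → ℝ} (h : IsTest θ) : Continuous θ := h.smooth.continuous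

lemma IsTest.integrable {θ : Space d → ℝ} (h : IsTest θ) : Integrable θ volume :=
  h.continuous.integrable_of_hasCompactSupport h.compact

lemma IsTest.differentiable {θ : Space d → ℝ} (h : IsTest θ) : Differentiable ℝ θ :=
  h.smooth.differentiable (by simp)

lemma IsTest.pderiv {θ : Space d → ℝ} (h : IsTest θ) (i : Fin d) : IsTest (pd i θ) :=
  ⟨(h.smooth.fderiv_right (m := (⊤ : ℕ∞)) (by simp)).clm_apply contDiff_const,
    h.compact.fderiv_apply ℝ _⟩

lemma IsTest.comp_neg {θ : Space d → ℝ} (h : IsTest θ) : IsTest fun x => θ (-x) :=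
  ⟨h.smooth.comp contDiff_neg, h.compact.comp_homeomorph (Homeomorph.neg _)⟩

lemma pd_comp_neg (i : Fin d) {θ : Space d → ℝ} (h : IsTest θ) :
    (pd i fun x => θ (-x)) = fun x => -pd i θ (-x) := by
  ext x
  have h1 : HasFDerivAt (fun x => θ (-x)) ((fderiv ℝ θ (-x)).comp
      (-ContinuousLinearMap.id ℝ (Space d))) x :=
    (h.differentiable (-x)).hasFDerivAt.comp x (hasFDerivAt_id x).neg
  simp [pd, h1.fderiv]

lemma pd_neg (i : Fin d) (θ : Space d → ℝ) : (pd i fun x => -θ x) = fun x => -pd i θ x := by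
  ext x
  simp [pd, fderiv_fun_neg]

lemma IsTest.pd_comm {θ : Space d → ℝ} (h : IsTest θ) (i j : Fin d) :
    pd i (pd j θ) =
      pd j (pd i θ) := by
  have hs : ∀ x, IsSymmSndFDerivAt ℝ θ x := fun x =>
    h.smooth.contDiffAt.isSymmSndFDerivAt (by simp; norm_cast)
  have hd : Differentiable ℝ (fderiv ℝ θ) :=
    (h.smooth.fderiv_right (m := 1) (by norm_cast)).differentiable (by simp)
  have key : ∀ (i j : Fin d) x, pd i (pd j θ) x =
      fderiv ℝ (fderiv ℝ θ) x (unitVec i) (unitVec j) := by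
    intro i j x
    have : HasFDerivAt (pd j θ) ((ContinuousLinearMap.apply ℝ ℝ
        (unitVec j : Space d)).comp (fderiv ℝ (fderiv ℝ θ) x)) x :=
      (ContinuousLinearMap.apply ℝ ℝ (unitVec j : Space d)).hasFDerivAt.comp x (hd x).hasFDerivAt
    rw [StationaryPotential.pd, this.fderiv]
    rfl
  ext x
  rw [key, key, (hs x).eq]

lemma IsTest.integral_pd {θ : Space d → ℝ} (h : IsTest θ) (i : Fin d) :
    ∫ x, pd i θ x = 0 := by
  have := integral_mul_fderiv_eq_neg_fderiv_mul_of_integrable (μ := (volume : Measure (Space d)))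
    (f := fun _ => (1 : ℝ)) (g := θ) (v := unitVec i) (by simp)
    (by simp only [one_mul]; exact (h.pderiv i).integrable) (by simpa using h.integrable) (by simp)
    (fun x _ => h.differentiable x)
  simp only [fderiv_fun_const, Pi.zero_apply, _root_.zero_apply, zero_mul,
    integral_zero, neg_zero, one_mul] at this
  exact this

variable (d) in
/-- A smooth approximate identity. -/
def bump (n : ℕ) : ContDiffBump (0 : Space d) :=
  ⟨1 / (n + 1), 2 / (n + 1), by positivity, by gcongr; norm_num⟩

variable (d) in
/-- The normalised mollifiers. -/
def mollifier (n : ℕ) : Space d → ℝ := (bump d n).normed volume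

lemma isTest_mollifier (n : ℕ) : IsTest (mollifier d n) :=
  ⟨(bump d n).contDiff_normed, (bump d n).hasCompactSupport_normed⟩

lemma mollifier_nonneg (n : ℕ) (x : Space d) : 0 ≤ mollifier d n x :=
  (bump d n).nonneg_normed x

lemma integral_mollifier (n : ℕ) : ∫ x, mollifier d n x = 1 := (bump d n).integral_normed

lemma ae_tendsto_mollifier {u : Space d → ℝ} (hu : LocallyIntegrable u volume) :
    ∀ᵐ x, Tendsto (fun n => convolution (mollifier d n) u (ContinuousLinearMap.lsmul ℝ ℝ) volume x) atTop
      (𝓝 (u x)) := by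
  -- `K = 2` is the fixed ratio of outer to inner radius of the bumps, which the Lebesgue
  -- differentiation argument needs bounded.
  refine ContDiffBump.ae_convolution_tendsto_right_of_locallyIntegrable (K := 2) ?_ ?_ hu
  · have := (tendsto_const_div_atTop_nhds_zero_nat (2 : ℝ)).comp (tendsto_add_atTop_nat 1)
    refine this.congr fun n => ?_
    simp [bump]
  · refine Eventually.of_forall fun n => le_of_eq ?_
    simp only [bump]
    ring

end Test

/-! ### Convolution on `Ω` -/

section Conv

variable {Ω : Type*} [MeasurableSpace Ω] {d : ℕ} [AddAction (Space d) Ω]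

/-- Convolution of a function on `Ω` along the shifts. -/
def conv (θ : Space d → ℝ) (u : Ω → ℝ) (ω : Ω) : ℝ := ∫ x, θ x * u (-x +ᵥ ω)

/-- Along each orbit this is ordinary convolution, so the regularity theory on Euclidean space
applies pointwise in `ω`. The sign `-x` in `conv` is chosen for this. -/
lemma realisation_conv (θ : Space d → ℝ) (u : Ω → ℝ) (ω : Ω) :
    realisation d (conv θ u) ω =
      convolution θ (realisation d u ω) (ContinuousLinearMap.lsmul ℝ ℝ) volume := by
  ext x
  simp only [realisation, conv, convolution_lsmul, smul_eq_mul, vadd_vadd]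
  refine integral_congr_ae (ae_of_all _ fun t => ?_)
  dsimp only
  rw [neg_add_eq_sub]

variable [MeasurableVAdd₂ (Space d) Ω] {P : Measure Ω} [IsProbabilityMeasure P]
  [VAddInvariantMeasure (Space d) Ω P]

lemma measurable_conv {θ : Space d → ℝ} (hθ : Measurable θ) {u : Ω → ℝ} (hu : Measurable u) :
    Measurable (conv θ u) := by
  refine StronglyMeasurable.measurable ?_
  refine StronglyMeasurable.integral_prod_left' (f := fun z : Space d × Ω =>
    θ z.1 * u (-z.1 +ᵥ z.2)) (Measurable.stronglyMeasurable ?_)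
  exact (hθ.comp measurable_fst).mul (measurable_shift measurable_neg hu)

lemma contDiff_conv {θ : Space d → ℝ} (hθ : IsTest θ) {u : Ω → ℝ} {ω : Ω}
    (hu : LocallyIntegrable (realisation d u ω) volume) :
    ContDiff ℝ (⊤ : ℕ∞) (realisation d (conv θ u) ω) := by
  rw [realisation_conv]
  exact hθ.compact.contDiff_convolution_left _ hθ.smooth hu

lemma pd_conv {θ : Space d → ℝ} (hθ : IsTest θ) {u : Ω → ℝ} {ω : Ω}
    (hu : LocallyIntegrable (realisation d u ω) volume) (i : Fin d) :
    pd i (realisation d (conv θ u) ω) = realisation d (conv (pd i θ) u) ω := by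
  ext x
  rw [realisation_conv, realisation_conv, pd,
    (hθ.compact.hasFDerivAt_convolution_left (ContinuousLinearMap.lsmul ℝ ℝ)
      (hθ.smooth.of_le (by norm_cast)) hu x).fderiv]
  have hex := (hθ.compact.fderiv ℝ).convolutionExists_left
    ((ContinuousLinearMap.lsmul ℝ ℝ (E := ℝ)).precompL (Space d))
    (hθ.smooth.continuous_fderiv (by simp)) hu x
  rw [convolution, ContinuousLinearMap.integral_apply hex, convolution_lsmul]
  rfl

lemma abs_conv_le {θ : Space d → ℝ} (hθ : Integrable θ volume) {u : Ω → ℝ} {C : ℝ}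
    (hC : ∀ ω, |u ω| ≤ C) (ω : Ω) : |conv θ u ω| ≤ (∫ x, |θ x|) * C := by
  rw [conv, ← integral_mul_const]
  refine norm_integral_le_of_norm_le (f := fun x => θ x * u (-x +ᵥ ω)) (hθ.abs.mul_const C)
    (ae_of_all _ fun x => ?_)
  rw [Real.norm_eq_abs, abs_mul]
  exact mul_le_mul_of_nonneg_left (hC _) (abs_nonneg _)

/-- All derivatives fall on the kernel, so only a sup bound on `u` is needed. The induction runs
over all test kernels at once, because one derivative replaces `θ` by its partial derivatives. -/
lemma iteratedFDeriv_conv_bounded (n : ℕ) {u : Ω → ℝ} (hu : Measurable u) {C : ℝ}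
    (hC : ∀ ω, |u ω| ≤ C) : ∀ {θ : Space d → ℝ}, IsTest θ →
    ∃ B : ℝ, ∀ ω x, ‖iteratedFDeriv ℝ n (realisation d (conv θ u) ω) x‖ ≤ B := by
  induction n with
  | zero =>
    intro θ hθ
    refine ⟨(∫ x, |θ x|) * C, fun ω x => ?_⟩
    rw [norm_iteratedFDeriv_zero]
    exact abs_conv_le hθ.integrable hC _
  | succ n ih =>
    intro θ hθ
    choose B hB using fun i => ih (hθ.pderiv i)
    refine ⟨∑ i, ‖ContinuousLinearMap.toSpanSingleton ℝ
      (EuclideanSpace.proj i : Space d →L[ℝ] ℝ)‖ * B i, fun ω x => ?_⟩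
    have hl := locallyIntegrable_of_bounded (d := d) hu hC ω
    have e : fderiv ℝ (realisation d (conv θ u) ω) = fun x => ∑ i,
        (ContinuousLinearMap.toSpanSingleton ℝ (EuclideanSpace.proj i : Space d →L[ℝ] ℝ) ∘
          realisation d (conv (pd i θ) u) ω) x := by
      ext x v
      have hv : v = ∑ i, v i • (unitVec i : Space d) := by
        ext j
        simp [Finset.sum_apply, Pi.single_apply]
      conv_lhs => rw [hv]
      rw [map_sum]
      simp only [_root_.sum_apply]
      refine Finset.sum_congr rfl fun i _ => ?_
      rw [map_smul, Function.comp_apply, ← pd_conv hθ hl i]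
      simp [pd, mul_comm]
    have hcd : ∀ i, ContDiff ℝ (⊤ : ℕ∞) (realisation d (conv (pd i θ) u) ω) :=
      fun i => contDiff_conv (hθ.pderiv i) hl
    rw [← norm_iteratedFDeriv_fderiv, e, iteratedFDeriv_sum, Finset.sum_apply]
    · refine (norm_sum_le _ _).trans (Finset.sum_le_sum fun i _ => ?_)
      refine (ContinuousLinearMap.norm_iteratedFDeriv_comp_left _ (hcd i).contDiffAt
        (by exact_mod_cast le_top)).trans ?_
      exact mul_le_mul_of_nonneg_left (hB i ω x) (norm_nonneg _)
    · intro i _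
      exact (ContinuousLinearMap.contDiff _).comp ((hcd i).of_le (by exact_mod_cast le_top))

lemma isSmoothBounded_conv {θ : Space d → ℝ} (hθ : IsTest θ) {u : Ω → ℝ} (hu : Measurable u)
    {C : ℝ} (hC : ∀ ω, |u ω| ≤ C) : IsSmoothBounded d (conv θ u) := by
  refine ⟨fun ω => contDiff_conv hθ (locallyIntegrable_of_bounded hu hC ω), fun n => ?_⟩
  obtain ⟨B, hB⟩ := iteratedFDeriv_conv_bounded n hu hC hθ
  exact ⟨B, fun ω => hB ω 0⟩

lemma integral_conv {θ : Space d → ℝ} (hθ : Integrable θ volume) {u : Ω → ℝ}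
    (hu : Integrable u P) : ∫ ω, conv θ u ω ∂P = (∫ x, θ x) * ∫ ω, u ω ∂P :=
  integral_integral_mul_vadd (s := fun x => -x) measurable_neg hθ hu

/-- Lebesgue differentiation on almost every orbit, transferred to `Ω`. -/
lemma ae_tendsto_conv_mollifier {u : Ω → ℝ} (hu : Measurable u) (hi : Integrable u P) :
    ∀ᵐ ω ∂P, Tendsto (fun n => conv (mollifier d n) u ω) atTop (𝓝 (u ω)) := by
  refine ae_of_ae_ae_vadd (d := d) (measurableSet_tendsto_fun
    (fun n => measurable_conv (isTest_mollifier n).continuous.measurable hu) hu) ?_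
  filter_upwards [ae_locallyIntegrable (d := d) hi] with ω hω
  filter_upwards [ae_tendsto_mollifier hω] with x hx
  simp_rw [← realisation_conv] at hx
  exact hx

/-- The adjoint of convolution with `θ` is convolution with the reflected kernel. -/
lemma integral_mul_conv {θ : Space d → ℝ} (hθ : Integrable θ volume) {u g : Ω → ℝ}
    (hu : Integrable u P) (hg : Measurable g) {C : ℝ} (hC : ∀ ω, |g ω| ≤ C) :
    ∫ ω, u ω * conv θ g ω ∂P = ∫ ω, conv (fun x => θ (-x)) u ω * g ω ∂P := by
  have e1 : ∀ ω, u ω * conv θ g ω = ∫ x, u ω * (θ x * g (-x +ᵥ ω)) := fun ω =>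
    (integral_const_mul _ _).symm
  have e2 : ∀ ω, conv (fun x => θ (-x)) u ω * g ω = ∫ x, θ x * u (x +ᵥ ω) * g ω := by
    intro ω
    rw [conv, ← integral_mul_const]
    have := integral_neg_eq_self (fun x : Space d => θ x * u (x +ᵥ ω) * g ω) volume
    rw [← this]
  simp_rw [e1, e2]
  have i1 : Integrable (fun z : Space d × Ω => θ z.1 * u z.2) (volume.prod P) := hθ.mul_prod hu
  have i2 : Integrable (fun z : Space d × Ω => θ z.1 * u (z.1 +ᵥ z.2)) (volume.prod P) :=
    integrable_mul_shift measurable_id hθ hu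
  have i1' : Integrable (fun z : Space d × Ω => u z.2 * (θ z.1 * g (-z.1 +ᵥ z.2)))
      (volume.prod P) := by
    refine (i1.mul_bdd (c := C) (g := fun z : Space d × Ω => g (-z.1 +ᵥ z.2)) ?_ (ae_of_all _ fun z => hC _)).congr
      (ae_of_all _ fun z => ?_)
    · exact (measurable_shift measurable_neg hg).aestronglyMeasurable
    · dsimp only; ring
  have i2' : Integrable (fun z : Space d × Ω => θ z.1 * u (z.1 +ᵥ z.2) * g z.2)
      (volume.prod P) :=
    i2.mul_bdd (c := C) (hg.comp measurable_snd).aestronglyMeasurable (ae_of_all _ fun z => hC _)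
  rw [integral_integral_swap (f := fun ω x => u ω * (θ x * g (-x +ᵥ ω))) i1'.swap,
    integral_integral_swap (f := fun ω x => θ x * u (x +ᵥ ω) * g ω) i2'.swap]
  refine integral_congr_ae (ae_of_all _ fun x => ?_)
  dsimp only
  rw [← integral_vadd_eq_self (μ := P) (fun ω => u ω * (θ x * g (-x +ᵥ ω))) (g := x)]
  refine integral_congr_ae (ae_of_all _ fun ω => ?_)
  simp only [neg_vadd_vadd]
  ring

end Conv

/-! ### Smooth functions on `Ω` -/

section Smooth

variable {Ω : Type*} [MeasurableSpace Ω] {d : ℕ} [AddAction (Space d) Ω]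
  [MeasurableVAdd₂ (Space d) Ω] {P : Measure Ω} [IsProbabilityMeasure P]
  [VAddInvariantMeasure (Space d) Ω P]

/-- The classical partial derivative on `Ω`. -/
def cpd (i : Fin d) (f : Ω → ℝ) (ω : Ω) : ℝ := pd i (realisation d f ω) 0

lemma realisation_cpd (i : Fin d) (f : Ω → ℝ) (ω : Ω) :
    realisation d (cpd i f) ω = pd i (realisation d f ω) := by
  ext x
  have : realisation d f (x +ᵥ ω) = fun z => realisation d f ω (z + x) :=
    funext fun z => realisation_vadd f x z ω
  change pd i (realisation d f (x +ᵥ ω)) 0 = _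
  rw [this, pd, fderiv_comp_add_right, zero_add, pd]

lemma IsSmoothBounded.differentiable {f : Ω → ℝ} (h : IsSmoothBounded d f) (ω : Ω) :
    Differentiable ℝ (realisation d f ω) :=
  (h.1 ω).differentiable (by simp)

lemma IsSmoothBounded.exists_bound {f : Ω → ℝ} (h : IsSmoothBounded d f) :
    ∃ C, ∀ ω, |f ω| ≤ C := by
  obtain ⟨C, hC⟩ := h.2 0
  refine ⟨C, fun ω => ?_⟩
  simpa [realisation] using hC ω

lemma IsSmoothBounded.exists_bound_cpd {f : Ω → ℝ} (h : IsSmoothBounded d f) :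
    ∃ C, ∀ (i : Fin d) ω, |cpd i f ω| ≤ C := by
  obtain ⟨C, hC⟩ := h.2 1
  refine ⟨C, fun i ω => ?_⟩
  have h1 := (fderiv ℝ (realisation d f ω) 0).le_opNorm (unitVec i)
  have h2 := hC ω
  rw [norm_iteratedFDeriv_one] at h2
  simp only [PiLp.norm_single, norm_one, mul_one] at h1
  exact h1.trans h2

lemma IsSmoothBounded.add {f g : Ω → ℝ} (hf : IsSmoothBounded d f) (hg : IsSmoothBounded d g) :
    IsSmoothBounded d (f + g) := by
  refine ⟨fun ω => (hf.1 ω).add (hg.1 ω), fun n => ?_⟩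
  obtain ⟨B, hB⟩ := hf.2 n
  obtain ⟨C, hC⟩ := hg.2 n
  refine ⟨B + C, fun ω => ?_⟩
  have e : realisation d (f + g) ω = realisation d f ω + realisation d g ω := rfl
  rw [e, iteratedFDeriv_add ((hf.1 ω).of_le (by exact_mod_cast le_top))
    ((hg.1 ω).of_le (by exact_mod_cast le_top))]
  exact (norm_add_le _ _).trans (add_le_add (hB ω) (hC ω))

lemma IsSmoothBounded.smul {f : Ω → ℝ} (hf : IsSmoothBounded d f) (c : ℝ) :
    IsSmoothBounded d (c • f) := by
  refine ⟨fun ω => (hf.1 ω).const_smul c, fun n => ?_⟩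
  obtain ⟨B, hB⟩ := hf.2 n
  refine ⟨‖c‖ * B, fun ω => ?_⟩
  have e : realisation d (c • f) ω = c • realisation d f ω := rfl
  rw [e, iteratedFDeriv_const_smul_apply
    ((hf.1 ω).contDiffAt.of_le (by exact_mod_cast le_top)), norm_smul]
  exact mul_le_mul_of_nonneg_left (hB ω) (norm_nonneg _)

/-- Bounded functions which are exactly invariant under the shifts are smooth. -/
lemma isSmoothBounded_of_invariant {f : Ω → ℝ} (hf : ∀ (x : Space d) ω, f (x +ᵥ ω) = f ω) {C : ℝ}
    (hC : ∀ ω, |f ω| ≤ C) : IsSmoothBounded d f := by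
  have e : ∀ ω, realisation d f ω = fun _ => f ω := fun ω => funext fun x => hf x ω
  refine ⟨fun ω => by rw [e]; exact contDiff_const, fun n => ⟨C, fun ω => ?_⟩⟩
  rw [e]
  rcases n with _ | n
  · simpa using hC ω
  · rw [iteratedFDeriv_const_of_ne (by simp)]
    simpa using (abs_nonneg _).trans (hC ω)

lemma cpd_of_invariant {f : Ω → ℝ} (hf : ∀ (x : Space d) ω, f (x +ᵥ ω) = f ω) (i : Fin d)
    (ω : Ω) : cpd i f ω = 0 := by
  have e : realisation d f ω = fun _ => f ω := funext fun x => hf x ω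
  simp [cpd, pd, e]

lemma cpd_add {f g : Ω → ℝ} (hf : IsSmoothBounded d f) (hg : IsSmoothBounded d g) (i : Fin d)
    (ω : Ω) : cpd i (f + g) ω = cpd i f ω + cpd i g ω := by
  have e : realisation d (f + g) ω = realisation d f ω + realisation d g ω := rfl
  simp only [cpd, pd, e]
  rw [fderiv_add (hf.differentiable ω _) (hg.differentiable ω _)]
  rfl

lemma cpd_smul {f : Ω → ℝ} (hf : IsSmoothBounded d f) (c : ℝ) (i : Fin d)
    (ω : Ω) : cpd i (c • f) ω = c * cpd i f ω := by
  have e : realisation d (c • f) ω = c • realisation d f ω := rfl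
  simp only [cpd, pd, e]
  rw [fderiv_const_smul (hf.differentiable ω _)]
  rfl

lemma classicalDiv_eq (φ : Ω → Space d) (ω : Ω) :
    classicalDiv φ ω = ∑ i, cpd i (fun ω' => φ ω' i) ω := rfl

lemma classicalGrad_apply {f : Ω → ℝ} (ω : Ω) (i : Fin d) :
    classicalGrad d f ω i = cpd i f ω := by
  have h1 : classicalGrad d f ω i = ⟪(unitVec i : Space d), classicalGrad d f ω⟫ := by
    simp [EuclideanSpace.inner_single_left]
  rw [h1, real_inner_comm, classicalGrad, gradient, InnerProductSpace.toDual_symm_apply]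
  rfl

lemma cpd_conv {θ : Space d → ℝ} (hθ : IsTest θ) {u : Ω → ℝ} (hu : Measurable u)
    {C : ℝ} (hC : ∀ ω, |u ω| ≤ C) (i : Fin d) : cpd i (conv θ u) = conv (pd i θ) u := by
  ext ω
  rw [cpd, pd_conv hθ (locallyIntegrable_of_bounded hu hC ω)]
  simp [realisation]

/-- The derivative is a pointwise limit of difference quotients with step `1/n`, each measurable in
`ω`. -/
lemma measurable_cpd {f : Ω → ℝ} (hf : Measurable f) (hs : IsSmoothBounded d f) (i : Fin d) :
    Measurable (cpd i f) := by
  refine measurable_of_tendsto_metrizable (f := fun (n : ℕ) ω =>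
    ((n : ℝ)) * (f (((n : ℝ)⁻¹ • (unitVec i : Space d)) +ᵥ ω) - f ω)) (fun n => ?_) ?_
  · exact measurable_const.mul ((hf.comp (measurable_const_vadd _)).sub hf)
  · rw [tendsto_pi_nhds]
    intro ω
    have h := (hs.differentiable ω 0).hasFDerivAt.lim (unitVec i : Space d)
      (l := atTop) (c := fun n : ℕ => (n : ℝ)) (by simpa using tendsto_natCast_atTop_atTop)
    simpa [realisation, cpd, pd] using h

lemma memLp_of_abs_le {f : Ω → ℝ} (hf : Measurable f) {C : ℝ} (hC : ∀ ω, |f ω| ≤ C) (p : ℝ≥0∞) :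
    MemLp f p P :=
  MemLp.of_bound hf.aestronglyMeasurable C (ae_of_all _ hC)

lemma isWeakPartial_cpd {f : Ω → ℝ} (hf : Measurable f) (hs : IsSmoothBounded d f) (i : Fin d) :
    IsWeakPartial P i f (cpd i f) := by
  refine ⟨measurable_cpd hf hs i, ae_of_all _ fun ω => ?_⟩
  rw [realisation_cpd]
  have hc : Continuous (pd i (realisation d f ω)) := continuous_fderiv_apply_test (hs.1 ω) _
  have hc0 : Continuous (realisation d f ω) := (hs.1 ω).continuous
  refine ⟨hc0.locallyIntegrable, hc.locallyIntegrable, fun φ hφ hφc => ?_⟩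
  exact integral_mul_fderiv_eq_neg_fderiv_mul_of_integrable
    (LocallyIntegrable.integrable_mul_test hc.locallyIntegrable hφ.continuous hφc)
    (LocallyIntegrable.integrable_mul_test hc0.locallyIntegrable
      (continuous_fderiv_apply_test hφ _) (hφc.fderiv_apply ℝ _))
    (LocallyIntegrable.integrable_mul_test hc0.locallyIntegrable hφ.continuous hφc)
    (fun x _ => hs.differentiable ω x) (fun x _ => hφ.differentiable (by simp) x)

lemma mem_Ds {f : Ω → ℝ} (hf : Measurable f) (hs : IsSmoothBounded d f) : f ∈ Ds d P := by
  obtain ⟨C, hC⟩ := hs.exists_bound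
  obtain ⟨C', hC'⟩ := hs.exists_bound_cpd
  exact ⟨mem_Dw_of hf (memLp_of_abs_le hf hC 2) (fun i => isWeakPartial_cpd hf hs i)
    fun i => memLp_of_abs_le (measurable_cpd hf hs i) (hC' i) 2, hs⟩

lemma measurable_of_mem_Ds (hd : 1 ≤ d) {f : Ω → ℝ} (hf : f ∈ Ds d P) : Measurable f :=
  ((mem_Dw_iff hd).1 hf.1).1

lemma Ds_add (hd : 1 ≤ d) {f g : Ω → ℝ} (hf : f ∈ Ds d P) (hg : g ∈ Ds d P) : f + g ∈ Ds d P :=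
  ⟨Dw_add hd hf.1 hg.1, hf.2.add hg.2⟩

lemma Ds_smul (hd : 1 ≤ d) {f : Ω → ℝ} (hf : f ∈ Ds d P) (c : ℝ) : c • f ∈ Ds d P :=
  ⟨Dw_smul hd hf.1 c, hf.2.smul c⟩

lemma Ds_const (c : ℝ) : (fun _ : Ω => c) ∈ Ds d P :=
  mem_Ds measurable_const (isSmoothBounded_of_invariant (fun _ _ => rfl) fun _ => le_rfl)

lemma conv_mem_Ds {θ : Space d → ℝ} (hθ : IsTest θ) {u : Ω → ℝ} (hu : Measurable u)
    {C : ℝ} (hC : ∀ ω, |u ω| ≤ C) : conv θ u ∈ Ds d P :=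
  mem_Ds (measurable_conv hθ.continuous.measurable hu) (isSmoothBounded_conv hθ hu hC)

lemma weakGrad_ae_eq_classicalGrad {f : Ω → ℝ} (hf : Measurable f) (hs : IsSmoothBounded d f) :
    weakGrad d P f =ᵐ[P] classicalGrad d f := by
  refine weakGrad_ae_eq fun i => ?_
  simp_rw [classicalGrad_apply]
  exact isWeakPartial_cpd hf hs i

/-- Integration by parts on `Ω`. -/
lemma integral_weakPartial_mul (hd : 1 ≤ d) {w h : Ω → ℝ} (hw : w ∈ Dw d P) (hh : h ∈ Ds d P)
    (i : Fin d) : ∫ ω, weakPartial P i w ω * h ω ∂P = -∫ ω, w ω * cpd i h ω ∂P := by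
  have hhm := measurable_of_mem_Ds hd hh
  rw [mem_Dw_iff hd] at hw
  obtain ⟨-, hw2, hwi⟩ := hw
  obtain ⟨C, hC⟩ := hh.2.exists_bound
  obtain ⟨C', hC'⟩ := hh.2.exists_bound_cpd
  -- Realisations of `h` lack compact support, so they cannot serve as test functions. Any cutoff of
  -- integral one repairs this: averaging over shifts leaves expectations unchanged, and the extra
  -- term with the derivative of the cutoff has weight `∫ ∂_i θ = 0`.
  set θ := mollifier d 0 with hθ
  have ht : IsTest θ := isTest_mollifier 0
  have i0 : Integrable (fun ω => weakPartial P i w ω * h ω) P :=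
    ((hwi i).2.integrable one_le_two).mul_bdd (c := C) hhm.aestronglyMeasurable (ae_of_all _ hC)
  have i1 : Integrable (fun ω => w ω * h ω) P :=
    (hw2.integrable one_le_two).mul_bdd (c := C) hhm.aestronglyMeasurable (ae_of_all _ hC)
  have i2 : Integrable (fun ω => w ω * cpd i h ω) P :=
    (hw2.integrable one_le_two).mul_bdd (c := C') (measurable_cpd hhm hh.2 i).aestronglyMeasurable
      (ae_of_all _ (hC' i))
  have a0 := integral_integral_mul_vadd (P := P) measurable_id ht.integrable i0
  have a1 := integral_integral_mul_vadd (P := P) measurable_id (ht.pderiv i).integrable i1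
  have a2 := integral_integral_mul_vadd (P := P) measurable_id ht.integrable i2
  rw [hθ, integral_mollifier, one_mul] at a0 a2
  rw [ht.integral_pd, zero_mul] at a1
  have key : ∫ ω, ∫ x, mollifier d 0 x * (weakPartial P i w (id x +ᵥ ω) * h (id x +ᵥ ω)) ∂volume ∂P =
      -(∫ ω, ∫ x, mollifier d 0 x * (w (id x +ᵥ ω) * cpd i h (id x +ᵥ ω)) ∂volume ∂P +
        ∫ ω, ∫ x, pd i θ x * (w (id x +ᵥ ω) * h (id x +ᵥ ω)) ∂volume ∂P) := by
    rw [← integral_add, ← integral_neg]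
    rotate_left
    · exact (integrable_mul_shift (P := P) measurable_id ht.integrable i2).integral_prod_right
    · exact (integrable_mul_shift (P := P) measurable_id (ht.pderiv i).integrable
        i1).integral_prod_right
    refine integral_congr_ae ?_
    filter_upwards [(hwi i).1.2, (integrable_mul_shift (P := P) measurable_id ht.integrable
      i2).prod_left_ae, (integrable_mul_shift (P := P) measurable_id (ht.pderiv i).integrable
      i1).prod_left_ae] with ω hω j2 j1
    have hsm := hh.2.1 ω
    have hprod := hω.2.2 (fun x => θ x * realisation d h ω x) (ht.smooth.mul hsm)
      ht.compact.mul_right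
    rw [← integral_add j2 j1]
    rw [neg_eq_iff_eq_neg.symm] at hprod
    have e1 : ∫ x, θ x * (weakPartial P i w (id x +ᵥ ω) * h (id x +ᵥ ω)) =
        ∫ x, realisation d (weakPartial P i w) ω x * (θ x * realisation d h ω x) := by
      refine integral_congr_ae (ae_of_all _ fun x => ?_)
      simp only [realisation, id]
      ring
    rw [e1, ← hprod]
    congr 1
    refine integral_congr_ae (ae_of_all _ fun x => ?_)
    have e2 : fderiv ℝ (fun x => θ x * realisation d h ω x) x (unitVec i) =
        θ x * cpd i h (x +ᵥ ω) + pd i θ x * h (x +ᵥ ω) := by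
      have : cpd i h (x +ᵥ ω) = realisation d (cpd i h) ω x := rfl
      rw [this, realisation_cpd, fderiv_fun_mul (ht.differentiable x) (hh.2.differentiable ω x)]
      simp only [pd, realisation, _root_.add_apply, _root_.smul_apply, smul_eq_mul]
      ring
    dsimp only
    rw [e2]
    simp only [realisation, id]
    ring
  rw [a0, a1, a2, add_zero] at key
  exact key

/-- The expectation of a derivative along the shifts vanishes. -/
lemma integral_eq_zero_of_hasDerivAt {F F' : Ω → ℝ} (hF : Integrable F P) (hF' : Integrable F' P)
    (e : Space d) (h : ∀ᵐ ω ∂P, (∀ t : ℝ, HasDerivAt (fun t : ℝ => F (t • e +ᵥ ω))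
      (F' (t • e +ᵥ ω)) t) ∧ Continuous fun t : ℝ => F' (t • e +ᵥ ω)) : ∫ ω, F' ω ∂P = 0 := by
  -- Average over shifts by `t • e` with `t ∈ (0, 1]`: the inner integral becomes an increment of
  -- `F`, whose expectation vanishes by invariance.
  have a := integral_integral_mul_vadd (P := P) (μ := volume.restrict (Set.Ioc (0 : ℝ) 1))
    (s := fun t => t • e) (by fun_prop) (integrable_const (1 : ℝ)) hF'
  simp only [integral_const, one_mul, smul_eq_mul, mul_one] at a
  have : (volume.restrict (Set.Ioc (0 : ℝ) 1)).real Set.univ = 1 := by simp [Measure.real]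
  rw [this, one_mul] at a
  rw [← a]
  have e1 : ∀ᵐ ω ∂P, ∫ t in Set.Ioc (0 : ℝ) 1, F' (t • e +ᵥ ω) = F (e +ᵥ ω) - F ω := by
    filter_upwards [h] with ω hω
    rw [← intervalIntegral.integral_of_le zero_le_one,
      intervalIntegral.integral_eq_sub_of_hasDerivAt (fun t _ => hω.1 t)
        (hω.2.intervalIntegrable _ _)]
    simp
  rw [integral_congr_ae e1, integral_sub _ hF, integral_vadd_eq_self, sub_self]
  exact (measurePreserving_vadd e P).integrable_comp_of_integrable hF

end Smooth

/-! ### Stationary harmonic functions are invariant -/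

section Liouville

variable {Ω : Type*} [MeasurableSpace Ω] {d : ℕ} [AddAction (Space d) Ω]
  [MeasurableVAdd₂ (Space d) Ω] {P : Measure Ω} [IsProbabilityMeasure P]
  [VAddInvariantMeasure (Space d) Ω P]

lemma integrable_conv {θ : Space d → ℝ} (hθ : Integrable θ volume) {u : Ω → ℝ}
    (hu : Integrable u P) : Integrable (conv θ u) P :=
  (integrable_mul_shift (s := fun x => -x) measurable_neg hθ hu).integral_prod_right

/-- Cauchy–Schwarz over the compact support of the kernel, then Tonelli and invariance of `P`.
Boundedness of `u` is not available where this is applied. -/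
lemma memLp_conv {θ : Space d → ℝ} (hθ : IsTest θ) {u : Ω → ℝ} (hu : Measurable u)
    (hu2 : MemLp u 2 P) : MemLp (conv θ u) 2 P := by
  set K := tsupport θ with hK
  have hKc : IsCompact K := hθ.compact
  have hb : ∀ ω, ‖conv θ u ω‖ₑ ^ (2 : ℝ) ≤
      (∫⁻ x in K, ‖θ x‖ₑ ^ (2 : ℝ)) * ∫⁻ x in K, ‖u (-x +ᵥ ω)‖ₑ ^ (2 : ℝ) := by
    intro ω
    have e : conv θ u ω = ∫ x in K, θ x * u (-x +ᵥ ω) := by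
      rw [conv, setIntegral_eq_integral_of_forall_compl_eq_zero]
      intro x hx
      rw [image_eq_zero_of_notMem_tsupport hx, zero_mul]
    have h1 : ‖conv θ u ω‖ₑ ≤ ∫⁻ x in K, ‖θ x‖ₑ * ‖u (-x +ᵥ ω)‖ₑ := by
      rw [e]
      refine (enorm_integral_le_lintegral_enorm _).trans (le_of_eq ?_)
      simp_rw [enorm_mul]
    have h2 := ENNReal.lintegral_mul_le_Lp_mul_Lq (volume.restrict K)
      Real.HolderConjugate.two_two (f := fun x => ‖θ x‖ₑ) (g := fun x => ‖u (-x +ᵥ ω)‖ₑ)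
      hθ.continuous.measurable.enorm.aemeasurable
      (hu.comp (measurable_neg.vadd measurable_const)).enorm.aemeasurable
    refine (ENNReal.rpow_le_rpow (h1.trans h2) zero_le_two).trans (le_of_eq ?_)
    rw [ENNReal.mul_rpow_of_nonneg _ _ zero_le_two, ← ENNReal.rpow_mul, ← ENNReal.rpow_mul]
    simp
  refine ⟨(measurable_conv hθ.continuous.measurable hu).aestronglyMeasurable, ?_⟩
  rw [eLpNorm_lt_top_iff_lintegral_rpow_enorm_lt_top two_ne_zero ENNReal.ofNat_ne_top]
  have hu3 := (eLpNorm_lt_top_iff_lintegral_rpow_enorm_lt_top two_ne_zero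
    ENNReal.ofNat_ne_top).1 hu2.2
  simp only [ENNReal.toReal_ofNat] at hu3 ⊢
  refine (lintegral_mono hb).trans_lt ?_
  have hm : Measurable fun z : Ω × Space d => ‖u (-z.2 +ᵥ z.1)‖ₑ ^ (2 : ℝ) :=
    (hu.comp (measurable_snd.neg.vadd measurable_fst)).enorm.pow_const _
  rw [lintegral_const_mul _ hm.lintegral_prod_right', lintegral_lintegral_swap hm.aemeasurable]
  refine ENNReal.mul_lt_top ?_ ?_
  · obtain ⟨B, hB⟩ := hθ.compact.exists_bound_of_continuous hθ.continuous
    refine (lintegral_mono (g := fun _ => ENNReal.ofReal B ^ (2 : ℝ)) fun x => ?_).trans_lt ?_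
    · refine ENNReal.rpow_le_rpow ?_ zero_le_two
      rw [← ofReal_norm]
      exact ENNReal.ofReal_le_ofReal (hB x)
    · rw [lintegral_const]
      refine ENNReal.mul_lt_top (by simp) ?_
      simpa using hKc.measure_lt_top
  · have : ∀ x : Space d, ∫⁻ ω, ‖u (-x +ᵥ ω)‖ₑ ^ (2 : ℝ) ∂P = ∫⁻ ω, ‖u ω‖ₑ ^ (2 : ℝ) ∂P :=
      fun x => (measurePreserving_vadd (-x) P).lintegral_comp (hu.enorm.pow_const _)
    simp_rw [this]
    rw [lintegral_const]
    refine ENNReal.mul_lt_top hu3 ?_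
    simpa using hKc.measure_lt_top

lemma hasDerivAt_conv {θ : Space d → ℝ} (hθ : IsTest θ) {u : Ω → ℝ} {ω : Ω}
    (hu : LocallyIntegrable (realisation d u ω) volume) (i : Fin d) (t : ℝ) :
    HasDerivAt (fun t : ℝ => conv θ u (t • (unitVec i : Space d) +ᵥ ω))
      (conv (pd i θ) u (t • (unitVec i : Space d) +ᵥ ω)) t := by
  have h1 : HasDerivAt (fun t : ℝ => t • (unitVec i : Space d)) (unitVec i : Space d) t := by
    simpa using (hasDerivAt_id t).smul_const (unitVec i : Space d)
  have h2 := ((contDiff_conv hθ hu).differentiable (by simp)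
    (t • (unitVec i : Space d))).hasFDerivAt.comp_hasDerivAt t h1
  have h3 := congrFun (pd_conv hθ hu i) (t • (unitVec i : Space d))
  rw [pd] at h3
  rw [h3] at h2
  exact h2

lemma continuous_conv_line {θ : Space d → ℝ} (hθ : IsTest θ) {u : Ω → ℝ} {ω : Ω}
    (hu : LocallyIntegrable (realisation d u ω) volume) (e : Space d) :
    Continuous fun t : ℝ => conv θ u (t • e +ᵥ ω) :=
  (contDiff_conv hθ hu).continuous.comp (continuous_id.smul continuous_const)

/-- A stationary field whose regularisation is harmonic has regularisation with zero gradient. -/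
lemma conv_pd_eq_zero_of_harmonic {ρ : Space d → ℝ} (hρ : IsTest ρ) {u : Ω → ℝ}
    (hu : Measurable u) (hu2 : MemLp u 2 P)
    (h : ∀ᵐ ω ∂P, ∑ j, conv (pd j (pd j ρ)) u ω = 0) (j : Fin d) :
    ∀ᵐ ω ∂P, conv (pd j ρ) u ω = 0 := by
  have hL : ∀ {θ : Space d → ℝ}, IsTest θ → MemLp (conv θ u) 2 P := fun hθ => memLp_conv hθ hu hu2
  have hsq : ∀ j, Integrable (fun ω => conv (pd j ρ) u ω * conv (pd j ρ) u ω) P := fun j =>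
    (hL (hρ.pderiv j)).integrable_mul (hL (hρ.pderiv j))
  have hmix : ∀ j, Integrable (fun ω => conv ρ u ω * conv (pd j (pd j ρ)) u ω) P := fun j =>
    (hL hρ).integrable_mul (hL ((hρ.pderiv j).pderiv j))
  -- With `U` the regularised field, `E[(∂_j U)²] = -E[U ∂_j² U]`. Summing over `j` produces the
  -- Laplacian of `U`, which vanishes.
  have hibp : ∀ j, ∫ ω, conv (pd j ρ) u ω * conv (pd j ρ) u ω ∂P =
      -∫ ω, conv ρ u ω * conv (pd j (pd j ρ)) u ω ∂P := by
    intro j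
    rw [eq_neg_iff_add_eq_zero, ← integral_add (hsq j) (hmix j)]
    refine integral_eq_zero_of_hasDerivAt (F := fun ω => conv ρ u ω * conv (pd j ρ) u ω)
      ((hL hρ).integrable_mul (hL (hρ.pderiv j))) ((hsq j).add (hmix j)) (unitVec j : Space d) ?_
    filter_upwards [ae_locallyIntegrable (d := d) (hu2.integrable one_le_two)] with ω hω
    refine ⟨fun t => ?_, ?_⟩
    · exact (hasDerivAt_conv hρ hω j t).mul (hasDerivAt_conv (hρ.pderiv j) hω j t)
    · exact ((continuous_conv_line (hρ.pderiv j) hω _).mul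
        (continuous_conv_line (hρ.pderiv j) hω _)).add
        ((continuous_conv_line hρ hω _).mul
        (continuous_conv_line ((hρ.pderiv j).pderiv j) hω _))
  have hsum : ∑ j, ∫ ω, conv (pd j ρ) u ω * conv (pd j ρ) u ω ∂P = 0 := by
    simp_rw [hibp]
    rw [Finset.sum_neg_distrib, ← integral_finsetSum _ fun j _ => hmix j, neg_eq_zero]
    refine integral_eq_zero_of_ae ?_
    filter_upwards [h] with ω hω
    rw [← Finset.mul_sum, hω, mul_zero, Pi.zero_apply]
  have h0 := (Finset.sum_eq_zero_iff_of_nonneg fun j _ =>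
    integral_nonneg fun ω => mul_self_nonneg (conv (pd j ρ) u ω)).1 hsum j (Finset.mem_univ j)
  rw [integral_eq_zero_iff_of_nonneg (fun ω => mul_self_nonneg _) (hsq j)] at h0
  filter_upwards [h0] with ω hω
  exact mul_self_eq_zero.1 hω

/-- Every mollification is smooth with zero gradient along a typical orbit, hence constant there.
The mollifications converge to `u` almost everywhere on that orbit. -/
lemma ae_const_of_conv_pd_eq_zero {u : Ω → ℝ} (hu : Measurable u) (hi : Integrable u P)
    (h : ∀ n (j : Fin d), ∀ᵐ ω ∂P, conv (pd j (mollifier d n)) u ω = 0) :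
    ∀ᵐ ω ∂P, ∃ c, ∀ᵐ x : Space d, u (x +ᵥ ω) = c := by
  have h' : ∀ᵐ ω ∂P, ∀ n (j : Fin d), ∀ᵐ x : Space d,
      conv (pd j (mollifier d n)) u (x +ᵥ ω) = 0 :=
    ae_all_iff.2 fun n => ae_all_iff.2 fun j => ae_ae_vadd (h n j)
  filter_upwards [h', ae_locallyIntegrable (d := d) hi,
    ae_ae_vadd (d := d) (ae_tendsto_conv_mollifier (d := d) hu hi)] with ω h1 hl h2
  have hconst : ∀ n (x : Space d), conv (mollifier d n) u (x +ᵥ ω) = conv (mollifier d n) u ω := by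
    intro n x
    have ht := isTest_mollifier (d := d) n
    have hz : ∀ (j : Fin d) x, pd j (realisation d (conv (mollifier d n) u) ω) x = 0 := by
      intro j
      rw [pd_conv ht hl]
      have hc : Continuous (realisation d (conv (pd j (mollifier d n)) u) ω) :=
        (contDiff_conv (ht.pderiv j) hl).continuous
      have := Continuous.ae_eq_iff_eq (μ := (volume : Measure (Space d))) hc
        (continuous_const (y := (0 : ℝ)))
      exact fun x => congrFun (this.1 (h1 n j)) x
    have hf : ∀ x, fderiv ℝ (realisation d (conv (mollifier d n) u) ω) x = 0 := by
      intro x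
      ext v
      have hv : v = ∑ i, v i • (unitVec i : Space d) := by
        ext j
        simp [Finset.sum_apply, Pi.single_apply]
      rw [hv, map_sum]
      refine Finset.sum_eq_zero fun i _ => ?_
      rw [map_smul]
      have := hz i x
      rw [pd] at this
      rw [this, smul_zero]
    have := is_const_of_fderiv_eq_zero ((contDiff_conv ht hl).differentiable (by simp)) hf x 0
    simpa [realisation] using this
  simp_rw [hconst] at h2
  obtain ⟨x₀, hx₀⟩ := h2.exists
  refine ⟨u (x₀ +ᵥ ω), ?_⟩
  filter_upwards [h2] with x hx
  exact tendsto_nhds_unique hx hx₀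

/-- A function with almost surely constant realisations has an exactly invariant version. -/
lemma exists_invariant_version {u : Ω → ℝ} (hu : Measurable u)
    (h : ∀ᵐ ω ∂P, ∃ c, ∀ᵐ x : Space d, u (x +ᵥ ω) = c) :
    ∃ k : Ω → ℝ, Measurable k ∧ (∀ (x : Space d) ω, k (x +ᵥ ω) = k ω) ∧ k =ᵐ[P] u := by
  -- A probability measure with the null sets of Lebesgue measure: averaging against it recovers the
  -- constant value on an orbit.
  set ν := (volume : Measure (Space d)).toFinite with hν
  have hae : ∀ {p : Space d → Prop}, (∀ᵐ x ∂ν, p x) ↔ ∀ᵐ x : Space d, p x := fun {p} => by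
    rw [hν, Filter.Eventually, ae_toFinite]; rfl
  set A := {ω : Ω | ∃ c, ∀ᵐ x : Space d, u (x +ᵥ ω) = c} with hA
  have hAm : MeasurableSet A := by
    -- Being almost everywhere constant is the vanishing of a double integral of differences, which
    -- is measurable in `ω`.
    have e : A = {ω | ∫⁻ x : Space d, ∫⁻ z : Space d, ‖u (x +ᵥ ω) - u (z +ᵥ ω)‖ₑ ∂ν ∂ν = 0} := by
      ext ω
      have hmω : Measurable fun x : Space d => u (x +ᵥ ω) := measurable_realisation hu ω
      have hmm : Measurable fun z : Space d × Space d => ‖u (z.1 +ᵥ ω) - u (z.2 +ᵥ ω)‖ₑ :=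
        ((hmω.comp measurable_fst).sub (hmω.comp measurable_snd)).enorm
      have hm1 : ∀ x : Space d, Measurable fun z : Space d => ‖u (x +ᵥ ω) - u (z +ᵥ ω)‖ₑ :=
        fun x => (measurable_const.sub hmω).enorm
      simp only [hA, Set.mem_ofPred_eq]
      rw [lintegral_eq_zero_iff hmm.lintegral_prod_right']
      constructor
      · rintro ⟨c, hc⟩
        rw [← hae] at hc
        filter_upwards [hc] with x hx
        rw [Pi.zero_apply, lintegral_eq_zero_iff (hm1 x)]
        filter_upwards [hc] with z hz
        simp [hx, hz]
      · intro hc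
        obtain ⟨x, hx⟩ := hc.exists
        have hx : ∫⁻ z : Space d, ‖u (x +ᵥ ω) - u (z +ᵥ ω)‖ₑ ∂ν = 0 := hx
        rw [lintegral_eq_zero_iff (hm1 x)] at hx
        refine ⟨u (x +ᵥ ω), ?_⟩
        rw [← hae]
        filter_upwards [hx] with z hz
        simp only [Pi.zero_apply, enorm_eq_zero, sub_eq_zero] at hz
        exact hz.symm
    rw [e]
    have h3 : Measurable fun q : (Ω × Space d) × Space d =>
        ‖u (q.1.2 +ᵥ q.1.1) - u (q.2 +ᵥ q.1.1)‖ₑ := by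
      refine Measurable.enorm (Measurable.sub (hu.comp ?_) (hu.comp ?_))
      · exact (measurable_snd.comp measurable_fst).vadd (measurable_fst.comp measurable_fst)
      · exact measurable_snd.vadd (measurable_fst.comp measurable_fst)
    have h4 := h3.lintegral_prod_right' (ν := ν)
    exact (h4.lintegral_prod_right' (ν := ν)) (measurableSet_singleton 0)
  have hval : ∀ {ω c}, (∀ᵐ x : Space d, u (x +ᵥ ω) = c) → ∫ x : Space d, u (x +ᵥ ω) ∂ν = c := by
    intro ω c hc
    rw [integral_congr_ae (hae.2 hc)]
    simp
  have hshift : ∀ {ω c} (x : Space d), (∀ᵐ z : Space d, u (z +ᵥ ω) = c) →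
      ∀ᵐ z : Space d, u (z +ᵥ (x +ᵥ ω)) = c := by
    intro ω c x hc
    have := (measurePreserving_add_right (volume : Measure (Space d)) x).quasiMeasurePreserving.ae hc
    simpa [vadd_vadd] using this
  -- The orbit average on `A`, and `0` off it. Since `A` is a union of whole orbits, this is
  -- invariant for every shift and every `ω`, with no exceptional set.
  refine ⟨A.indicator fun ω => ∫ x : Space d, u (x +ᵥ ω) ∂ν, ?_, ?_, ?_⟩
  · refine Measurable.indicator (StronglyMeasurable.measurable ?_) hAm
    exact StronglyMeasurable.integral_prod_right' (f := fun z : Ω × Space d => u (z.2 +ᵥ z.1))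
      (hu.comp (measurable_snd.vadd measurable_fst)).stronglyMeasurable
  · intro x ω
    by_cases hω : ω ∈ A
    · obtain ⟨c, hc⟩ := hω
      have hc' := hshift x hc
      rw [Set.indicator_of_mem (show x +ᵥ ω ∈ A from ⟨c, hc'⟩),
        Set.indicator_of_mem (show ω ∈ A from ⟨c, hc⟩), hval hc, hval hc']
    · have hω' : x +ᵥ ω ∉ A := by
        rintro ⟨c, hc⟩
        refine hω ⟨c, ?_⟩
        have := hshift (-x) hc
        simpa using this
      rw [Set.indicator_of_notMem hω, Set.indicator_of_notMem hω']
  · refine ae_of_ae_ae_vadd (d := d) (measurableSet_eq_fun ?_ hu) ?_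
    · refine Measurable.indicator (StronglyMeasurable.measurable ?_) hAm
      exact StronglyMeasurable.integral_prod_right' (f := fun z : Ω × Space d => u (z.2 +ᵥ z.1))
        (hu.comp (measurable_snd.vadd measurable_fst)).stronglyMeasurable
    · filter_upwards [h] with ω ⟨c, hc⟩
      filter_upwards [hc] with x hx
      have hc' := hshift x hc
      rw [Set.indicator_of_mem (show x +ᵥ ω ∈ A from ⟨c, hc'⟩), hval hc', hx]

end Liouville

/-! ### Density of smooth divergence-free fields -/

section Density

variable {Ω : Type*} [MeasurableSpace Ω] {d : ℕ} [AddAction (Space d) Ω]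
  [MeasurableVAdd₂ (Space d) Ω] {P : Measure Ω} [IsProbabilityMeasure P]
  [VAddInvariantMeasure (Space d) Ω P]

variable (d P) in
/-- Smooth bounded divergence-free vector fields. -/
def DivFree : Set (Ω → Space d) :=
  {φ | (∀ i : Fin d, (fun ω => φ ω i) ∈ Ds d P) ∧ ∀ ω, classicalDiv φ ω = 0}

lemma memLp_component {ψ : Ω → Space d} {p : ℝ≥0∞} (h : MemLp ψ p P) (i : Fin d) :
    MemLp (fun ω => ψ ω i) p P :=
  (EuclideanSpace.proj i : Space d →L[ℝ] ℝ).comp_memLp' h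

lemma inner_eq_sum (x y : Space d) : ⟪x, y⟫ = ∑ i, x i * y i := by
  simp [PiLp.inner_apply, mul_comm]

lemma integrable_inner {φ ψ : Ω → Space d} (hφ : MemLp φ 2 P) (hψ : MemLp ψ 2 P) :
    Integrable (fun ω => ⟪φ ω, ψ ω⟫) P := by
  simp_rw [inner_eq_sum]
  exact integrable_finsetSum _ fun i _ =>
    (memLp_component hφ i).integrable_mul (memLp_component hψ i)

lemma integrable_component_mul {ψ : Ω → Space d} (hψ : MemLp ψ 2 P) {a : Ω → ℝ}
    (ha : MemLp a 2 P) (i : Fin d) : Integrable (fun ω => ψ ω i * a ω) P :=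
  (memLp_component hψ i).integrable_mul ha

/-- These two-component fields are the supply of divergence-free test fields. For `i ≠ j` they
detect the curl; `i = j` with `b = 0` yields invariant multiples of a unit vector. -/
lemma single_sub_single_mem_DivFree (hd : 1 ≤ d) (i j : Fin d) {a b : Ω → ℝ} (ha : a ∈ Ds d P)
    (hb : b ∈ Ds d P) (hab : ∀ ω, cpd i a ω = cpd j b ω) :
    (fun ω => EuclideanSpace.single i (a ω) - EuclideanSpace.single j (b ω)) ∈ DivFree d P := by
  have e : ∀ k : Fin d, (fun ω => (EuclideanSpace.single i (a ω) -
      EuclideanSpace.single j (b ω) : Space d) k) =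
      (if k = i then (1 : ℝ) else 0) • a + (-(if k = j then (1 : ℝ) else 0)) • b := by
    intro k
    ext ω
    simp only [PiLp.sub_apply, PiLp.single_apply, Pi.add_apply, Pi.smul_apply, smul_eq_mul]
    split_ifs <;> simp [sub_eq_add_neg]
  refine ⟨fun k => ?_, fun ω => ?_⟩
  · rw [e]
    exact Ds_add hd (Ds_smul hd ha _) (Ds_smul hd hb _)
  · rw [classicalDiv_eq]
    simp_rw [e]
    simp_rw [cpd_add (ha.2.smul _) (hb.2.smul _), cpd_smul ha.2, cpd_smul hb.2]
    simp [Finset.sum_add_distrib, hab]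

lemma integral_inner_single_sub_single {ψ : Ω → Space d} (hψ : MemLp ψ 2 P) (i j : Fin d)
    {a b : Ω → ℝ} (ha : MemLp a 2 P) (hb : MemLp b 2 P) :
    ∫ ω, ⟪ψ ω, EuclideanSpace.single i (a ω) - EuclideanSpace.single j (b ω)⟫ ∂P =
      ∫ ω, ψ ω i * a ω ∂P - ∫ ω, ψ ω j * b ω ∂P := by
  rw [← integral_sub (integrable_component_mul hψ ha i) (integrable_component_mul hψ hb j)]
  refine integral_congr_ae (ae_of_all _ fun ω => ?_)
  simp [inner_sub_right, EuclideanSpace.inner_single_right, mul_comm]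

/-- Truncating `k` at level `N` gives a bounded invariant `g`, so `g` times the `i`-th unit vector
is an admissible divergence-free field. Orthogonality then reads `E[g²] = 0`. -/
lemma ae_eq_zero_of_orthogonal_of_invariant {ψ : Ω → Space d} (hd : 1 ≤ d) (hψ : MemLp ψ 2 P)
    (hS : ∀ φ ∈ DivFree d P, ∫ ω, ⟪ψ ω, φ ω⟫ ∂P = 0) (i : Fin d) {k : Ω → ℝ}
    (hk : Measurable k) (hinv : ∀ (x : Space d) ω, k (x +ᵥ ω) = k ω)
    (hku : k =ᵐ[P] fun ω => ψ ω i) : ∀ᵐ ω ∂P, ψ ω i = 0 := by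
  have hz : ∀ N : ℕ, ∀ᵐ ω ∂P, |k ω| ≤ N → k ω = 0 := by
    intro N
    set g : Ω → ℝ := {ω | |k ω| ≤ N}.indicator k with hg
    have hs : MeasurableSet {ω | |k ω| ≤ N} := measurableSet_le hk.abs measurable_const
    have hgm : Measurable g := hk.indicator hs
    have hgi : ∀ (x : Space d) ω, g (x +ᵥ ω) = g ω := by
      intro x ω
      simp only [hg, Set.indicator, Set.mem_ofPred_eq, hinv]
    have hgb : ∀ ω, |g ω| ≤ N := by
      intro ω
      simp only [hg, Set.indicator, Set.mem_ofPred_eq]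
      split_ifs with h
      · exact h
      · simp
    have hgD : g ∈ Ds d P := mem_Ds hgm (isSmoothBounded_of_invariant hgi hgb)
    have h0D : (fun _ : Ω => (0 : ℝ)) ∈ Ds d P := Ds_const 0
    have h1 := hS _ (single_sub_single_mem_DivFree hd i i hgD h0D fun ω => by
      rw [cpd_of_invariant hgi, cpd_of_invariant fun _ _ => rfl])
    rw [integral_inner_single_sub_single hψ i i (memLp_of_abs_le hgm hgb 2)
      (memLp_of_abs_le measurable_const (C := 0) (by simp) 2)] at h1
    simp only [mul_zero, integral_zero, sub_zero] at h1
    have h2 : (fun ω => ψ ω i * g ω) =ᵐ[P] fun ω => g ω * g ω := by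
      filter_upwards [hku] with ω hω
      rw [← hω]
      simp only [hg, Set.indicator, Set.mem_ofPred_eq]
      split_ifs <;> simp
    rw [integral_congr_ae h2, integral_eq_zero_iff_of_nonneg (fun ω => mul_self_nonneg _)
      ((memLp_of_abs_le hgm hgb 2).integrable_mul (memLp_of_abs_le hgm hgb 2))] at h1
    filter_upwards [h1] with ω hω hle
    have := mul_self_eq_zero.1 hω
    simpa [hg, Set.indicator, hle] using this
  filter_upwards [ae_all_iff.2 hz, hku] with ω hω hω'
  obtain ⟨N, hN⟩ := exists_nat_ge |k ω|
  rw [← hω', hω N hN]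

/-- A square integrable field orthogonal to all gradients and to all smooth divergence-free
fields vanishes. -/
lemma ae_eq_zero_of_orthogonal (hd : 1 ≤ d) {ψ : Ω → Space d} (hm : Measurable ψ)
    (hψ : MemLp ψ 2 P) (hG : ∀ w ∈ Dw d P, ∫ ω, ⟪ψ ω, weakGrad d P w ω⟫ ∂P = 0)
    (hS : ∀ φ ∈ DivFree d P, ∫ ω, ⟪ψ ω, φ ω⟫ ∂P = 0) : ψ =ᵐ[P] 0 := by
  have hmi : ∀ i, Measurable fun ω => ψ ω i := fun i =>
    (EuclideanSpace.proj i : Space d →L[ℝ] ℝ).continuous.measurable.comp hm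
  have hu2 : ∀ i, MemLp (fun ω => ψ ω i) 2 P := memLp_component hψ
  have hui : ∀ i, Integrable (fun ω => ψ ω i) P := fun i => (hu2 i).integrable one_le_two
  -- A weak form of `Δ ψ_i = 0`: orthogonality to curl-type fields turns `∂_j ∂_j` paired with `ψ_i`
  -- into `∂_i ∂_j` paired with `ψ_j`. The sum over `j` is then the pairing of `ψ` with the gradient
  -- of `conv (pd i θ) g`.
  have hlap : ∀ {θ : Space d → ℝ}, IsTest θ → ∀ {g : Ω → ℝ}, Measurable g → ∀ {C : ℝ},
      (∀ ω, |g ω| ≤ C) → ∀ i, ∑ j, ∫ ω, ψ ω i * conv (pd j (pd j θ)) g ω ∂P = 0 := by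
    intro θ hθ g hg C hC i
    have hmem : ∀ {η : Space d → ℝ}, IsTest η → MemLp (conv η g) 2 P := fun hη =>
      memLp_of_abs_le (measurable_conv hη.continuous.measurable hg)
        (abs_conv_le hη.integrable hC) 2
    have hcurl : ∀ j, ∫ ω, ψ ω i * conv (pd j (pd j θ)) g ω ∂P =
        ∫ ω, ψ ω j * conv (pd i (pd j θ)) g ω ∂P := by
      intro j
      have ht1 := (hθ.pderiv j).pderiv j
      have ht2 := (hθ.pderiv j).pderiv i
      have h1 := hS _ (single_sub_single_mem_DivFree hd i j (conv_mem_Ds ht1 hg hC)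
        (conv_mem_Ds ht2 hg hC) fun ω => by
          rw [cpd_conv ht1 hg hC, cpd_conv ht2 hg hC, (hθ.pderiv j).pd_comm i j])
      rw [integral_inner_single_sub_single hψ i j (hmem ht1) (hmem ht2)] at h1
      exact sub_eq_zero.1 h1
    have hgrad := hG _ (conv_mem_Ds (P := P) (hθ.pderiv i) hg hC).1
    have hwg : ∀ᵐ ω ∂P, ∀ j, weakGrad d P (conv (pd i θ) g) ω j = conv (pd j (pd i θ)) g ω := by
      filter_upwards [weakGrad_ae_eq_classicalGrad (P := P)
        (measurable_conv (hθ.pderiv i).continuous.measurable hg)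
        (isSmoothBounded_conv (hθ.pderiv i) hg hC)] with ω hω j
      rw [hω, classicalGrad_apply, cpd_conv (hθ.pderiv i) hg hC]
    have e : ∫ ω, ⟪ψ ω, weakGrad d P (conv (pd i θ) g) ω⟫ ∂P =
        ∑ j, ∫ ω, ψ ω j * conv (pd j (pd i θ)) g ω ∂P := by
      rw [← integral_finsetSum _ fun j _ =>
        integrable_component_mul hψ (hmem ((hθ.pderiv i).pderiv j)) j]
      refine integral_congr_ae ?_
      filter_upwards [hwg] with ω hω
      rw [inner_eq_sum]
      simp_rw [hω]
    rw [e] at hgrad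
    rw [← hgrad]
    refine Finset.sum_congr rfl fun j _ => ?_
    rw [hcurl j, hθ.pd_comm]
  have hharm : ∀ {ρ : Space d → ℝ}, IsTest ρ → ∀ i,
      ∀ᵐ ω ∂P, ∑ j, conv (pd j (pd j ρ)) (fun ω => ψ ω i) ω = 0 := by
    intro ρ hρ i
    have hint : ∀ j, Integrable (conv (pd j (pd j ρ)) fun ω => ψ ω i) P := fun j =>
      integrable_conv ((hρ.pderiv j).pderiv j).integrable (hui i)
    have hsum : Integrable (fun ω => ∑ j, conv (pd j (pd j ρ)) (fun ω => ψ ω i) ω) P :=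
      integrable_finsetSum _ fun j _ => hint j
    -- Take `g` to be an indicator and move the convolution onto `ψ_i`. The kernel gets reflected,
    -- and the two signs from the second derivative cancel.
    refine hsum.ae_eq_zero_of_forall_setIntegral_eq_zero fun s hs _ => ?_
    have hgm : Measurable (s.indicator fun _ : Ω => (1 : ℝ)) := measurable_const.indicator hs
    have hgb : ∀ ω, |s.indicator (fun _ : Ω => (1 : ℝ)) ω| ≤ 1 := fun ω => by
      by_cases h : ω ∈ s <;> simp [h]
    have h1 := hlap hρ.comp_neg hgm hgb i
    have hj : ∀ j, ∫ ω, ψ ω i * conv (pd j (pd j fun x => ρ (-x)))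
        (s.indicator fun _ : Ω => (1 : ℝ)) ω ∂P =
        ∫ ω in s, conv (pd j (pd j ρ)) (fun ω => ψ ω i) ω ∂P := by
      intro j
      rw [integral_mul_conv ((hρ.comp_neg.pderiv j).pderiv j).integrable (hui i) hgm hgb]
      have e : (fun x => pd j (pd j fun x => ρ (-x)) (-x)) = pd j (pd j ρ) := by
        rw [pd_comp_neg j hρ, pd_neg, pd_comp_neg j (hρ.pderiv j)]
        simp
      rw [e, ← integral_indicator hs]
      refine integral_congr_ae (ae_of_all _ fun ω => ?_)
      by_cases h : ω ∈ s <;> simp [h]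
    simp_rw [hj] at h1
    rw [integral_finsetSum _ fun j _ => (hint j).integrableOn]
    exact h1
  have hcomp : ∀ i, ∀ᵐ ω ∂P, ψ ω i = 0 := by
    intro i
    have hc := ae_const_of_conv_pd_eq_zero (hmi i) (hui i) fun n j =>
      conv_pd_eq_zero_of_harmonic (isTest_mollifier (d := d) n) (hmi i) (hu2 i)
        (hharm (isTest_mollifier n) i) j
    obtain ⟨k, hk, hinv, hku⟩ := exists_invariant_version (hmi i) hc
    exact ae_eq_zero_of_orthogonal_of_invariant hd hψ hS i hk hinv hku
  filter_upwards [ae_all_iff.2 hcomp] with ω hω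
  ext i
  exact hω i

lemma memLp_of_mem_DivFree (hd : 1 ≤ d) {φ : Ω → Space d} (hφ : φ ∈ DivFree d P) (p : ℝ≥0∞) :
    MemLp φ p P :=
  memLp_of_components fun i => by
    obtain ⟨C, hC⟩ := (hφ.1 i).2.exists_bound
    exact memLp_of_abs_le (measurable_of_mem_Ds hd (hφ.1 i)) hC p

lemma DivFree_add (hd : 1 ≤ d) {φ χ : Ω → Space d} (hφ : φ ∈ DivFree d P)
    (hχ : χ ∈ DivFree d P) : φ + χ ∈ DivFree d P := by
  refine ⟨fun i => Ds_add hd (hφ.1 i) (hχ.1 i), fun ω => ?_⟩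
  have h1 := hφ.2 ω
  have h2 := hχ.2 ω
  rw [classicalDiv_eq] at h1 h2 ⊢
  have e : ∀ i, cpd i (fun ω' => (φ + χ) ω' i) ω =
      cpd i (fun ω' => φ ω' i) ω + cpd i (fun ω' => χ ω' i) ω := fun i =>
    cpd_add (hφ.1 i).2 (hχ.1 i).2 i ω
  simp_rw [e]
  rw [Finset.sum_add_distrib, h1, h2, add_zero]

lemma DivFree_smul (hd : 1 ≤ d) {φ : Ω → Space d} (hφ : φ ∈ DivFree d P) (c : ℝ) :
    c • φ ∈ DivFree d P := by
  refine ⟨fun i => Ds_smul hd (hφ.1 i) c, fun ω => ?_⟩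
  have h1 := hφ.2 ω
  rw [classicalDiv_eq] at h1 ⊢
  have e : ∀ i, cpd i (fun ω' => (c • φ) ω' i) ω = c * cpd i (fun ω' => φ ω' i) ω := fun i =>
    cpd_smul (hφ.1 i).2 c i ω
  simp_rw [e]
  rw [← Finset.mul_sum, h1, mul_zero]

lemma DivFree_const (y : Space d) : (fun _ : Ω => y) ∈ DivFree d P := by
  refine ⟨fun i => Ds_const (y i), fun ω => ?_⟩
  rw [classicalDiv_eq]
  exact Finset.sum_eq_zero fun i _ => cpd_of_invariant (fun _ _ => rfl) i ω

/-- Gradients are orthogonal to divergence-free fields. -/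
lemma integral_inner_weakGrad_eq_zero (hd : 1 ≤ d) {φ : Ω → Space d} (hφ : φ ∈ DivFree d P)
    {w : Ω → ℝ} (hw : w ∈ Dw d P) : ∫ ω, ⟪φ ω, weakGrad d P w ω⟫ ∂P = 0 := by
  have hw' := (mem_Dw_iff hd).1 hw
  simp_rw [inner_eq_sum]
  rw [integral_finsetSum _ fun i _ => 
    integrable_component_mul (memLp_of_mem_DivFree hd hφ 2)
      (memLp_component (memLp_weakGrad hd hw) i) i]
  have e : ∀ i, ∫ ω, φ ω i * weakGrad d P w ω i ∂P =
      -∫ ω, w ω * cpd i (fun ω' => φ ω' i) ω ∂P := by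
    intro i
    rw [← integral_weakPartial_mul hd hw (hφ.1 i)]
    refine integral_congr_ae (ae_of_all _ fun ω => ?_)
    exact mul_comm _ _
  have hint : ∀ i, Integrable (fun ω => w ω * cpd i (fun ω' => φ ω' i) ω) P := by
    intro i
    obtain ⟨C, hC⟩ := (hφ.1 i).2.exists_bound_cpd
    exact (hw'.2.1.integrable one_le_two).mul_bdd (c := C)
      (measurable_cpd (measurable_of_mem_Ds hd (hφ.1 i)) (hφ.1 i).2 i).aestronglyMeasurable
      (ae_of_all _ (hC i))
  simp_rw [e]
  rw [Finset.sum_neg_distrib, ← integral_finsetSum _ fun i _ => hint i, neg_eq_zero]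
  refine integral_eq_zero_of_ae (ae_of_all _ fun ω => ?_)
  have h := hφ.2 ω
  rw [classicalDiv_eq] at h
  dsimp only
  rw [← Finset.mul_sum, h, mul_zero, Pi.zero_apply]

/-- Smooth divergence-free fields as a subspace of `L²`. -/
def divFreeLp (hd : 1 ≤ d) : Submodule ℝ (Lp (Space d) 2 P) where
  carrier := {F | ∃ φ ∈ DivFree d P, F =ᵐ[P] φ}
  add_mem' := by
    rintro F G ⟨φ, hφ, h1⟩ ⟨χ, hχ, h2⟩
    exact ⟨_, DivFree_add hd hφ hχ, (Lp.coeFn_add F G).trans (h1.add h2)⟩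
  zero_mem' := ⟨_, DivFree_const 0, Lp.coeFn_zero _ _ _⟩
  smul_mem' := by
    rintro c F ⟨φ, hφ, h1⟩
    exact ⟨_, DivFree_smul hd hφ c, (Lp.coeFn_smul c F).trans (h1.const_smul c)⟩

/-- A square integrable field orthogonal to gradients is in the closure of the smooth
divergence-free fields. -/
lemma mem_closure_divFreeLp (hd : 1 ≤ d) (F : Lp (Space d) 2 P)
    (hF : ∀ w ∈ Dw d P, ∫ ω, ⟪F ω, weakGrad d P w ω⟫ ∂P = 0) :
    F ∈ (divFreeLp (P := P) hd).topologicalClosure := by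
  set S := divFreeLp (P := P) hd with hSdef
  rw [← Submodule.orthogonal_orthogonal_eq_closure, Submodule.mem_orthogonal]
  intro G hG
  rw [Submodule.mem_orthogonal] at hG
  set T : Submodule ℝ (Lp (Space d) 2 P) := S.topologicalClosure with hT
  have : CompleteSpace T := S.isClosed_topologicalClosure.completeSpace_coe
  -- Gradients are orthogonal to `S`, hence to `p`. So `F - p` is orthogonal both to gradients and
  -- to `S`, and must vanish.
  set p : Lp (Space d) 2 P := T.starProjection F with hp
  have hpT : p ∈ T := T.starProjection_apply_mem F
  have hpG : ∀ w ∈ Dw d P, ∫ ω, ⟪p ω, weakGrad d P w ω⟫ ∂P = 0 := by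
    intro w hw
    set W : Lp (Space d) 2 P := (memLp_weakGrad hd hw).toLp _ with hW
    have hS0 : ∀ q ∈ S, ⟪q, W⟫ = 0 := by
      rintro q ⟨φ, hφ, hq⟩
      rw [L2.inner_def, ← integral_inner_weakGrad_eq_zero hd hφ hw]
      refine integral_congr_ae ?_
      filter_upwards [hq, (memLp_weakGrad hd hw).coeFn_toLp] with ω h1 h2
      rw [h1, h2]
    have hW0 : W ∈ Sᗮ := (Submodule.mem_orthogonal _ _).2 hS0
    rw [← Submodule.orthogonal_closure] at hW0
    have := (Submodule.mem_orthogonal _ _).1 hW0 p hpT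
    rw [L2.inner_def] at this
    rw [← this]
    refine integral_congr_ae ?_
    filter_upwards [(memLp_weakGrad hd hw).coeFn_toLp] with ω h2
    rw [h2]
  have hψ : F - p = 0 := by
    have hsub := Lp.coeFn_sub F p
    rw [Lp.eq_zero_iff_ae_eq_zero]
    refine ae_eq_zero_of_orthogonal hd (Lp.stronglyMeasurable _).measurable (Lp.memLp _) ?_ ?_
    · intro w hw
      have h1 : ∫ ω, ⟪(F - p : Lp (Space d) 2 P) ω, weakGrad d P w ω⟫ ∂P =
          ∫ ω, (⟪F ω, weakGrad d P w ω⟫ - ⟪p ω, weakGrad d P w ω⟫) ∂P := by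
        refine integral_congr_ae ?_
        filter_upwards [hsub] with ω hω
        rw [hω, Pi.sub_apply, inner_sub_left]
      rw [h1, integral_sub (integrable_inner (Lp.memLp F) (memLp_weakGrad hd hw))
        (integrable_inner (Lp.memLp p) (memLp_weakGrad hd hw)), hF w hw, hpG w hw, sub_zero]
    · intro φ hφ
      have hmem : (memLp_of_mem_DivFree hd hφ 2).toLp φ ∈ T :=
        S.le_topologicalClosure ⟨φ, hφ, MemLp.coeFn_toLp _⟩
      have h1 := T.starProjection_inner_eq_zero F _ hmem
      rw [L2.inner_def] at h1
      rw [← h1]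
      refine integral_congr_ae ?_
      filter_upwards [(memLp_of_mem_DivFree hd hφ 2).coeFn_toLp] with ω h2
      rw [h2]
  rw [sub_eq_zero] at hψ
  rw [hψ]
  have hG' : G ∈ Sᗮ := (Submodule.mem_orthogonal _ _).2 hG
  rw [← Submodule.orthogonal_closure] at hG'
  rw [real_inner_comm]
  exact (Submodule.mem_orthogonal _ _).1 hG' p hpT

end Density

/-! ### Convex duality -/

/-- Solution of the constrained minimisation problem dual to the projection onto a subspace. -/
lemma exists_dual_minimiser {E V : Type*} [NormedAddCommGroup E] [InnerProductSpace ℝ E]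
    [CompleteSpace E] [NormedAddCommGroup V] [InnerProductSpace ℝ V] [FiniteDimensional ℝ V]
    (S : Submodule ℝ E) (L : V →L[ℝ] E) (hL : ∀ b, b ≠ 0 → ∃ ζ ∈ Sᗮ, ⟪ζ, L b⟫ ≠ 0) (y : V) :
    ∃ b, ∃ r ∈ Sᗮ, (∀ a, ⟪r, L a⟫ = ⟪y, a⟫) ∧ L b - r ∈ S.topologicalClosure := by
  have : CompleteSpace V := FiniteDimensional.complete ℝ V
  set Q := Sᗮ.starProjection with hQ
  -- With `r = Q (L b)` the constraint on `r` reads `T b = y`. Since `⟪T b, b⟫ = ‖Q (L b)‖²`, the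
  -- hypothesis on `L` makes `T` injective, hence surjective in finite dimension.
  set T : V →L[ℝ] V := L.adjoint.comp (Q.comp L) with hT
  have hinj : Function.Injective (T : V →ₗ[ℝ] V) := by
    rw [← LinearMap.ker_eq_bot, LinearMap.ker_eq_bot']
    intro b hb
    by_contra hne
    obtain ⟨ζ, hζ, hne'⟩ := hL b hne
    have h1 : ⟪T b, b⟫ = 0 := by
      have : T b = 0 := hb
      rw [this, inner_zero_left]
    rw [hT, ContinuousLinearMap.comp_apply, ContinuousLinearMap.adjoint_inner_left] at h1
    have h2 : ⟪Q (L b), Q (L b)⟫ = 0 := by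
      have h3 := Sᗮ.starProjection_inner_eq_zero (L b) (Q (L b)) (Sᗮ.starProjection_apply_mem _)
      rw [inner_sub_left, sub_eq_zero] at h3
      rw [← h3, real_inner_comm]
      exact h1
    rw [inner_self_eq_zero] at h2
    have h4 := Sᗮ.starProjection_inner_eq_zero (L b) ζ hζ
    have h2' : Sᗮ.starProjection (L b) = 0 := h2
    rw [h2', sub_zero, real_inner_comm] at h4
    exact hne' h4
  obtain ⟨b, hb⟩ := LinearMap.injective_iff_surjective.1 hinj y
  refine ⟨b, Q (L b), Sᗮ.starProjection_apply_mem _, fun a => ?_, ?_⟩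
  · rw [← hb]
    change _ = ⟪T b, a⟫
    rw [hT, ContinuousLinearMap.comp_apply, ContinuousLinearMap.adjoint_inner_left]
    rfl
  · rw [← Submodule.orthogonal_orthogonal_eq_closure]
    exact Sᗮ.sub_starProjection_mem_orthogonal _

/-! ### Weighted `L²` duality between gradients and divergence-free fields. -/

section Duality

variable {Ω : Type*} [MeasurableSpace Ω] {d : ℕ} [AddAction (Space d) Ω]
  [MeasurableVAdd₂ (Space d) Ω] {P : Measure Ω} [IsProbabilityMeasure P]
  [VAddInvariantMeasure (Space d) Ω P]

lemma norm_sq_Lp (F : Lp (Space d) 2 P) : ‖F‖ ^ 2 = ∫ ω, ‖F ω‖ ^ 2 ∂P := by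
  rw [← real_inner_self_eq_norm_sq, L2.inner_def]
  simp_rw [real_inner_self_eq_norm_sq]

lemma memLp_smul_of_bound {a : Ω → ℝ} (ha : Measurable a) {B : ℝ} (hB : ∀ᵐ ω ∂P, |a ω| ≤ B)
    {X : Ω → Space d} {p : ℝ≥0∞} (hX : MemLp X p P) : MemLp (fun ω => a ω • X ω) p P := by
  refine MemLp.of_le_mul (c := B) hX (ha.aestronglyMeasurable.smul hX.1) ?_
  filter_upwards [hB] with ω hω
  rw [norm_smul]
  exact mul_le_mul_of_nonneg_right hω (norm_nonneg _)

/-- Multiplication by an essentially bounded function on `L²`. -/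
def mulLp (a : Ω → ℝ) (ha : Measurable a) (B : ℝ) (hB : ∀ᵐ ω ∂P, |a ω| ≤ B) :
    Lp (Space d) 2 P →L[ℝ] Lp (Space d) 2 P :=
  LinearMap.mkContinuous
    { toFun := fun F => (memLp_smul_of_bound ha hB (Lp.memLp F)).toLp _
      map_add' := fun F G => by
        rw [← MemLp.toLp_add]
        refine MemLp.toLp_congr _ _ ?_
        filter_upwards [Lp.coeFn_add F G] with ω h
        rw [h]
        simp
      map_smul' := fun c F => by
        rw [RingHom.id_apply, ← MemLp.toLp_const_smul]
        refine MemLp.toLp_congr _ _ ?_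
        filter_upwards [Lp.coeFn_smul c F] with ω h
        rw [h]
        exact smul_comm (a ω) c (F ω) } B fun F => by
      refine Lp.norm_le_mul_norm_of_ae_le_mul ?_
      filter_upwards [hB, (memLp_smul_of_bound ha hB (Lp.memLp F)).coeFn_toLp] with ω h1 h2
      simp only [LinearMap.coe_mk, AddHom.coe_mk]
      rw [h2, norm_smul]
      exact mul_le_mul_of_nonneg_right h1 (norm_nonneg _)

lemma coeFn_mulLp {a : Ω → ℝ} (ha : Measurable a) {B : ℝ} (hB : ∀ᵐ ω ∂P, |a ω| ≤ B)
    (F : Lp (Space d) 2 P) : mulLp a ha B hB F =ᵐ[P] fun ω => a ω • F ω :=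
  (memLp_smul_of_bound ha hB (Lp.memLp F)).coeFn_toLp

lemma inner_mulLp {a : Ω → ℝ} (ha : Measurable a) {B : ℝ} (hB : ∀ᵐ ω ∂P, |a ω| ≤ B)
    (F G : Lp (Space d) 2 P) : ⟪mulLp a ha B hB F, G⟫ = ⟪F, mulLp a ha B hB G⟫ := by
  rw [L2.inner_def, L2.inner_def]
  refine integral_congr_ae ?_
  filter_upwards [coeFn_mulLp ha hB F, coeFn_mulLp ha hB G] with ω h1 h2
  rw [h1, h2, real_inner_smul_left, real_inner_smul_right]

lemma inner_constL (F : Lp (Space d) 2 P) (a : Space d) :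
    ⟪F, Lp.constL 2 P ℝ a⟫ = ⟪∫ ω, F ω ∂P, a⟫ := by
  rw [L2.inner_def, real_inner_comm, ← integral_inner ((Lp.memLp F).integrable one_le_two)]
  refine integral_congr_ae ?_
  filter_upwards [Lp.coeFn_const (p := 2) (μ := P) a] with ω h
  rw [show (Lp.constL 2 P ℝ a : Lp (Space d) 2 P) = Lp.const 2 P a from rfl, h, real_inner_comm]
  rfl

lemma adjoint_constL (F : Lp (Space d) 2 P) :
    (Lp.constL 2 P ℝ : Space d →L[ℝ] Lp (Space d) 2 P).adjoint F = ∫ ω, F ω ∂P := by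
  refine ext_inner_right ℝ fun a => ?_
  rw [ContinuousLinearMap.adjoint_inner_left, inner_constL]

/-- Gradients as a subspace of `L²`. -/
def gradLp (hd : 1 ≤ d) : Submodule ℝ (Lp (Space d) 2 P) where
  carrier := {F | ∃ w ∈ Dw d P, F =ᵐ[P] weakGrad d P w}
  add_mem' := by
    rintro F G ⟨w, hw, h1⟩ ⟨v, hv, h2⟩
    exact ⟨_, Dw_add hd hw hv, ((Lp.coeFn_add F G).trans (h1.add h2)).trans
      (weakGrad_add hd hw hv).symm⟩
  zero_mem' := by
    refine ⟨_, Dw_smul hd (Ds_const (P := P) (d := d) 0).1 0, ?_⟩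
    filter_upwards [Lp.coeFn_zero (Space d) 2 P, weakGrad_smul hd
      (Ds_const (P := P) (d := d) 0).1 0] with ω h1 h2
    rw [h1, h2, zero_smul]
    rfl
  smul_mem' := by
    rintro c F ⟨w, hw, h1⟩
    exact ⟨_, Dw_smul hd hw c, ((Lp.coeFn_smul c F).trans (h1.const_smul c)).trans
      (weakGrad_smul hd hw c).symm⟩

lemma eLpNorm_weakGrad_le (f : Ω → ℝ) : eLpNorm (weakGrad d P f) 2 P ≤ nablaNorm d P f := by
  have e : weakGrad d P f = ∑ i, fun ω => weakPartial P i f ω • (unitVec i : Space d) := by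
    ext ω j
    simp [weakGrad, Finset.sum_apply, Pi.single_apply]
  have hm : ∀ i : Fin d, AEStronglyMeasurable
      (fun ω => weakPartial P i f ω • (unitVec i : Space d)) P := fun i =>
    (measurable_weakPartial i f).aestronglyMeasurable.smul_const _
  conv_lhs => rw [e]
  refine (eLpNorm_sum_le (fun i _ => hm i) one_le_two).trans ?_
  refine le_add_left (Finset.sum_le_sum fun i _ => ?_)
  refine eLpNorm_mono fun ω => ?_
  rw [norm_smul]
  simp

/-- Measurable weights bounded above and below by positive constants. -/
structure IsWeight (P : Measure Ω) (f : Ω → ℝ) (c C : ℝ) : Prop where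
  measurable : Measurable f
  pos : 0 < c
  lower : ∀ᵐ ω ∂P, c < f ω
  upper : ∀ᵐ ω ∂P, f ω ≤ C

namespace IsWeight

variable {f : Ω → ℝ} {c C : ℝ}

lemma measurable_sqrt (h : IsWeight P f c C) : Measurable fun ω => √(f ω) :=
  h.measurable.sqrt

lemma sqrt_bound (h : IsWeight P f c C) : ∀ᵐ ω ∂P, |√(f ω)| ≤ √C := by
  filter_upwards [h.upper] with ω hω
  rw [abs_of_nonneg (Real.sqrt_nonneg _)]
  exact Real.sqrt_le_sqrt hω

lemma inv_sqrt_bound (h : IsWeight P f c C) : ∀ᵐ ω ∂P, |(√(f ω))⁻¹| ≤ (√c)⁻¹ := by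
  filter_upwards [h.lower] with ω hω
  rw [abs_of_nonneg (inv_nonneg.2 (Real.sqrt_nonneg _))]
  exact inv_anti₀ (Real.sqrt_pos.2 h.pos) (Real.sqrt_le_sqrt hω.le)

/-- Multiplication by the square root of a weight. -/
def sqrtMul (h : IsWeight P f c C) : Lp (Space d) 2 P →L[ℝ] Lp (Space d) 2 P :=
  mulLp _ h.measurable_sqrt _ h.sqrt_bound

/-- Division by the square root of a weight. -/
def sqrtDiv (h : IsWeight P f c C) : Lp (Space d) 2 P →L[ℝ] Lp (Space d) 2 P :=
  mulLp _ h.measurable_sqrt.inv _ h.inv_sqrt_bound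

lemma coeFn_sqrtMul (h : IsWeight P f c C) (F : Lp (Space d) 2 P) :
    h.sqrtMul F =ᵐ[P] fun ω => √(f ω) • F ω := coeFn_mulLp _ _ F

lemma coeFn_sqrtDiv (h : IsWeight P f c C) (F : Lp (Space d) 2 P) :
    h.sqrtDiv F =ᵐ[P] fun ω => (√(f ω))⁻¹ • F ω := coeFn_mulLp _ _ F

lemma sqrtDiv_sqrtMul (h : IsWeight P f c C) (F : Lp (Space d) 2 P) :
    h.sqrtDiv (h.sqrtMul F) = F := by
  refine Lp.ext ?_
  filter_upwards [h.coeFn_sqrtDiv (h.sqrtMul F), h.coeFn_sqrtMul F, h.lower] with ω h1 h2 h3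
  rw [h1, h2, inv_smul_smul₀ (Real.sqrt_pos.2 (h.pos.trans h3)).ne']

/-- The weights cancel in the pairing. Thus energies weighted by `f` for gradients and by `1/f` for
divergence-free fields are dual to each other. -/
lemma inner_sqrtDiv_sqrtMul (h : IsWeight P f c C) (F G : Lp (Space d) 2 P) :
    ⟪h.sqrtDiv F, h.sqrtMul G⟫ = ⟪F, G⟫ := by
  rw [sqrtDiv, inner_mulLp]
  exact congrArg _ (h.sqrtDiv_sqrtMul G)

lemma norm_sq_sqrtMul (h : IsWeight P f c C) {F : Lp (Space d) 2 P} {X : Ω → Space d}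
    (hF : F =ᵐ[P] X) : ‖h.sqrtMul F‖ ^ 2 = ∫ ω, ‖X ω‖ ^ 2 * f ω ∂P := by
  rw [norm_sq_Lp]
  refine integral_congr_ae ?_
  filter_upwards [h.coeFn_sqrtMul F, hF, h.lower] with ω h1 h2 h3
  rw [h1, h2, norm_smul, mul_pow, Real.norm_eq_abs, sq_abs, Real.sq_sqrt (h.pos.trans h3).le,
    mul_comm]

lemma norm_sq_sqrtDiv (h : IsWeight P f c C) {F : Lp (Space d) 2 P} {X : Ω → Space d}
    (hF : F =ᵐ[P] X) : ‖h.sqrtDiv F‖ ^ 2 = ∫ ω, ‖X ω‖ ^ 2 / f ω ∂P := by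
  rw [norm_sq_Lp]
  refine integral_congr_ae ?_
  filter_upwards [h.coeFn_sqrtDiv F, hF, h.lower] with ω h1 h2 h3
  rw [h1, h2, norm_smul, mul_pow, Real.norm_eq_abs, sq_abs, inv_pow,
    Real.sq_sqrt (h.pos.trans h3).le, div_eq_inv_mul]

end IsWeight

lemma mem_PhiS_iff {y : Space d} {φ : Ω → Space d} :
    φ ∈ PhiS P y ↔ φ ∈ DivFree d P ∧ ∫ ω, φ ω ∂P = y := by
  simp [PhiS, DivFree, and_assoc]

lemma const_mem_PhiS (y : Space d) : (fun _ : Ω => y) ∈ PhiS P y :=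
  mem_PhiS_iff.2 ⟨DivFree_const y, by simp⟩

lemma coeFn_constL_sub {w : Ω → ℝ} {η : Space d} {W : Lp (Space d) 2 P}
    (hW : W =ᵐ[P] weakGrad d P w) :
    (Lp.constL 2 P ℝ η - W : Lp (Space d) 2 P) =ᵐ[P] fun ω => η - weakGrad d P w ω := by
  filter_upwards [Lp.coeFn_sub (Lp.constL 2 P ℝ η) W, hW,
    Lp.coeFn_const (p := 2) (μ := P) η] with ω h1 h2 h3
  rw [h1, Pi.sub_apply, h2, show (Lp.constL 2 P ℝ η : Lp (Space d) 2 P) = Lp.const 2 P η from rfl,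
    h3]
  rfl

/-- The inequality between the primal and the dual problem. -/
lemma sq_inner_le (hd : 1 ≤ d) {f : Ω → ℝ} {c C : ℝ} (hf : IsWeight P f c C) {y η : Space d}
    {φ : Ω → Space d} (hφ : φ ∈ PhiS P y) {w : Ω → ℝ} (hw : w ∈ Dw d P) :
    ⟪y, η⟫ ^ 2 ≤ (∫ ω, ‖φ ω‖ ^ 2 / f ω ∂P) * ∫ ω, ‖η - weakGrad d P w ω‖ ^ 2 * f ω ∂P := by
  rw [mem_PhiS_iff] at hφ
  set F : Lp (Space d) 2 P := (memLp_of_mem_DivFree hd hφ.1 2).toLp φ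
  have hF : F =ᵐ[P] φ := MemLp.coeFn_toLp _
  set W : Lp (Space d) 2 P := (memLp_weakGrad hd hw).toLp _
  have hW : W =ᵐ[P] weakGrad d P w := MemLp.coeFn_toLp _
  have h1 : ⟪F, W⟫ = 0 := by
    rw [L2.inner_def, ← integral_inner_weakGrad_eq_zero hd hφ.1 hw]
    refine integral_congr_ae ?_
    filter_upwards [hF, hW] with ω h1 h2
    rw [h1, h2]
  have h2 : ⟪F, Lp.constL 2 P ℝ η⟫ = ⟪y, η⟫ := by
    rw [inner_constL, integral_congr_ae hF, hφ.2]
  have h3 := real_inner_mul_inner_self_le (hf.sqrtDiv F) (hf.sqrtMul (Lp.constL 2 P ℝ η - W))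
  rw [hf.inner_sqrtDiv_sqrtMul, inner_sub_right, h1, h2, sub_zero, real_inner_self_eq_norm_sq,
    real_inner_self_eq_norm_sq, hf.norm_sq_sqrtDiv hF,
    hf.norm_sq_sqrtMul (coeFn_constL_sub hW)] at h3
  rw [sq]
  exact h3

lemma bddBelow_H (D : Set (Ω → ℝ)) {f : Ω → ℝ} {c C : ℝ} (hf : IsWeight P f c C) (η : Space d) :
    BddBelow (Set.range fun w : D => ∫ ω, ‖η - weakGrad d P w ω‖ ^ 2 * f ω ∂P) := by
  refine ⟨0, ?_⟩
  rintro _ ⟨w, rfl⟩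
  refine integral_nonneg_of_ae ?_
  filter_upwards [hf.lower] with ω hω
  exact mul_nonneg (sq_nonneg _) (hf.pos.trans hω).le

variable {D : Set (Ω → ℝ)}

lemma TestClass_nonempty (hD : D ∈ TestClass d P) : Nonempty D := by
  obtain ⟨g, hg, -⟩ := hD.2 _ (Ds_const (P := P) (d := d) 0).1 1 one_pos
  exact ⟨g, hg⟩

lemma sq_inner_le_mul_H (hd : 1 ≤ d) (hD : D ∈ TestClass d P) {f : Ω → ℝ} {c C : ℝ}
    (hf : IsWeight P f c C) {y : Space d} (η : Space d) {φ : Ω → Space d} (hφ : φ ∈ PhiS P y) :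
    ⟪y, η⟫ ^ 2 ≤ (∫ ω, ‖φ ω‖ ^ 2 / f ω ∂P) * H P D (fun _ => η) f := by
  have := TestClass_nonempty hD
  rw [H, Real.mul_iInf_of_nonneg]
  · exact le_ciInf fun w => sq_inner_le hd hf hφ (hD.1 w.2)
  · refine integral_nonneg_of_ae ?_
    filter_upwards [hf.lower] with ω hω
    exact div_nonneg (sq_nonneg _) (hf.pos.trans hω).le

/-- Apply the duality inequality to the constant field `η`, which is divergence-free with mean `η`.
-/
lemma H_pos (hd : 1 ≤ d) (hD : D ∈ TestClass d P) {f : Ω → ℝ} {c C : ℝ}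
    (hf : IsWeight P f c C) {η : Space d} (hη : η ≠ 0) : 0 < H P D (fun _ => η) f := by
  have h := sq_inner_le_mul_H hd hD hf η (const_mem_PhiS (P := P) η)
  have h1 : 0 < ⟪η, η⟫ := real_inner_self_pos.2 hη
  have h2 : 0 ≤ ∫ ω : Ω, ‖η‖ ^ 2 / f ω ∂P := by
    refine integral_nonneg_of_ae ?_
    filter_upwards [hf.lower] with ω hω
    exact div_nonneg (sq_nonneg _) (hf.pos.trans hω).le
  by_contra hH
  have := mul_nonpos_of_nonneg_of_nonpos h2 (not_lt.1 hH)
  have := pow_pos h1 2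
  linarith

/-- `H` is defined through `D`, but the distance to the closed span of all weighted gradients is
what duality produces. Two closure arguments connect them: density of `D` in `Dw`, then continuity
of the norm. In particular the choice of `D` is irrelevant. -/
lemma H_le_norm_sq (hd : 1 ≤ d) (hD : D ∈ TestClass d P) {f : Ω → ℝ} {c C : ℝ}
    (hf : IsWeight P f c C) (η : Space d) {q : Lp (Space d) 2 P}
    (hq : q ∈ ((gradLp (P := P) hd).map hf.sqrtMul.toLinearMap).topologicalClosure) :
    H P D (fun _ => η) f ≤ ‖hf.sqrtMul (Lp.constL 2 P ℝ η) - q‖ ^ 2 := by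
  have hclosed : IsClosed {q : Lp (Space d) 2 P |
      H P D (fun _ => η) f ≤ ‖hf.sqrtMul (Lp.constL 2 P ℝ η) - q‖ ^ 2} :=
    isClosed_le continuous_const (by fun_prop)
  have hgrad : ∀ W ∈ gradLp (P := P) hd,
      H P D (fun _ => η) f ≤ ‖hf.sqrtMul (Lp.constL 2 P ℝ η) - hf.sqrtMul W‖ ^ 2 := by
    rintro W ⟨w, hw, hW⟩
    have hclosed' : IsClosed {W : Lp (Space d) 2 P | H P D (fun _ => η) f ≤
        ‖hf.sqrtMul (Lp.constL 2 P ℝ η) - hf.sqrtMul W‖ ^ 2} :=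
      isClosed_le continuous_const (by fun_prop)
    have hmem : W ∈ closure {G : Lp (Space d) 2 P | ∃ g ∈ D, G =ᵐ[P] weakGrad d P g} := by
      rw [EMetric.mem_closure_iff]
      intro ε hε
      obtain ⟨g, hg, hlt⟩ := hD.2 w hw ε hε
      have hgw := hD.1 hg
      refine ⟨(memLp_weakGrad hd hgw).toLp _, ⟨g, hg, MemLp.coeFn_toLp _⟩, ?_⟩
      refine lt_of_le_of_lt ?_ hlt
      rw [edist_comm, Lp.edist_def]
      refine le_trans (le_of_eq (eLpNorm_congr_ae ?_)) (eLpNorm_weakGrad_le (g - w))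
      filter_upwards [weakGrad_sub hd hgw hw, hW, (memLp_weakGrad hd hgw).coeFn_toLp]
        with ω h1 h2 h3
      rw [h1, Pi.sub_apply, h2, h3]
    refine closure_minimal ?_ hclosed' hmem
    rintro G ⟨g, hg, hG⟩
    rw [Set.mem_ofPred_eq, ← map_sub, hf.norm_sq_sqrtMul (coeFn_constL_sub hG)]
    exact ciInf_le (bddBelow_H D hf η) ⟨g, hg⟩
  refine closure_minimal ?_ hclosed hq
  rintro _ ⟨W, hW, rfl⟩
  exact hgrad W hW

variable (P) in
/-- The minimal weighted energy of divergence-free fields with given mean. -/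
def minEnergy (y : Space d) (f : Ω → ℝ) : ℝ := ⨅ φ : PhiS (Ω := Ω) P y, ∫ ω, ‖φ.1 ω‖ ^ 2 / f ω ∂P

lemma bddBelow_energy {f : Ω → ℝ} {c C : ℝ} (hf : IsWeight P f c C) (y : Space d) :
    BddBelow (Set.range fun φ : PhiS (Ω := Ω) P y => ∫ ω, ‖φ.1 ω‖ ^ 2 / f ω ∂P) := by
  refine ⟨0, ?_⟩
  rintro _ ⟨φ, rfl⟩
  refine integral_nonneg_of_ae ?_
  filter_upwards [hf.lower] with ω hω
  exact div_nonneg (sq_nonneg _) (hf.pos.trans hω).le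

lemma minEnergy_nonneg {f : Ω → ℝ} {c C : ℝ} (hf : IsWeight P f c C) (y : Space d) :
    0 ≤ minEnergy P y f := by
  refine Real.iInf_nonneg fun φ => integral_nonneg_of_ae ?_
  filter_upwards [hf.lower] with ω hω
  exact div_nonneg (sq_nonneg _) (hf.pos.trans hω).le

lemma div_H_le_minEnergy (hd : 1 ≤ d) (hD : D ∈ TestClass d P) {f : Ω → ℝ} {c C : ℝ}
    (hf : IsWeight P f c C) (y : Space d) {η : Space d} (hη : η ≠ 0) :
    ⟪y, η⟫ ^ 2 / H P D (fun _ => η) f ≤ minEnergy P y f := by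
  have : Nonempty (PhiS (Ω := Ω) P y) := ⟨_, const_mem_PhiS y⟩
  refine le_ciInf fun φ => ?_
  rw [div_le_iff₀ (H_pos hd hD hf hη)]
  exact sq_inner_le_mul_H hd hD hf η φ.2

/-- Smooth approximants of `F` have only approximately the right mean. Adding the constant field
that corrects the mean makes them admissible, and the correction depends continuously on the field
and vanishes at `F`. -/
lemma minEnergy_le_norm_sq (hd : 1 ≤ d) {f : Ω → ℝ} {c C : ℝ} (hf : IsWeight P f c C)
    {y : Space d} {F : Lp (Space d) 2 P} (hF : F ∈ (divFreeLp (P := P) hd).topologicalClosure)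
    (hy : ∫ ω, F ω ∂P = y) : minEnergy P y f ≤ ‖hf.sqrtDiv F‖ ^ 2 := by
  set A : Space d →L[ℝ] Lp (Space d) 2 P := Lp.constL 2 P ℝ with hA
  have hclosed : IsClosed {F : Lp (Space d) 2 P | minEnergy P y f ≤
      ‖hf.sqrtDiv (F + A (y - A.adjoint F))‖ ^ 2} :=
    isClosed_le continuous_const (by fun_prop)
  have key : F ∈ {F : Lp (Space d) 2 P | minEnergy P y f ≤
      ‖hf.sqrtDiv (F + A (y - A.adjoint F))‖ ^ 2} := by
    refine closure_minimal ?_ hclosed hF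
    rintro G ⟨φ, hφ, hG⟩
    set z : Space d := y - A.adjoint G with hz
    have hrep : (G + A z : Lp (Space d) 2 P) =ᵐ[P] φ + fun _ => z := by
      filter_upwards [Lp.coeFn_add G (A z), hG, Lp.coeFn_const (p := 2) (μ := P) z]
        with ω h1 h2 h3
      rw [h1, Pi.add_apply, h2, show A z = Lp.const 2 P z from rfl, h3]
      rfl
    have hmem : (φ + fun _ => z) ∈ PhiS P y := by
      refine mem_PhiS_iff.2 ⟨DivFree_add hd hφ (DivFree_const z), ?_⟩
      simp only [Pi.add_apply]
      rw [integral_add ((memLp_of_mem_DivFree hd hφ 2).integrable one_le_two) (integrable_const _),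
        ← integral_congr_ae hG, hz, hA, adjoint_constL]
      simp
    rw [Set.mem_ofPred_eq, hf.norm_sq_sqrtDiv hrep]
    exact ciInf_le (bddBelow_energy hf y) ⟨_, hmem⟩
  have h0 : A.adjoint F = y := by rw [hA, adjoint_constL, hy]
  rw [Set.mem_ofPred_eq, h0, sub_self, map_zero, add_zero] at key
  exact key

/-- The dual problem has no gap, and its supremum is attained. -/
lemma exists_minEnergy_le_div_H (hd : 1 ≤ d) (hD : D ∈ TestClass d P) {f : Ω → ℝ} {c C : ℝ}
    (hf : IsWeight P f c C) (y : Space d) :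
    ∃ η : Metric.sphere (0 : Space d) 1,
      minEnergy P y f ≤ ⟪y, (η : Space d)⟫ ^ 2 / H P D (fun _ => (η : Space d)) f := by
  -- For `y = 0` the zero field has zero energy and any direction works; for `y ≠ 0` the optimal `b`
  -- will be nonzero and can be normalised.
  rcases eq_or_ne y 0 with rfl | hy
  · refine ⟨⟨unitVec ⟨0, hd⟩, by simp⟩, ?_⟩
    refine (ciInf_le (bddBelow_energy hf 0) ⟨_, const_mem_PhiS 0⟩).trans ?_
    simp
  set S := (gradLp (P := P) hd).map (hf.sqrtMul (d := d)).toLinearMap with hS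
  set A : Space d →L[ℝ] Lp (Space d) 2 P := Lp.constL 2 P ℝ with hA
  have hconst : ∀ (b : Space d), ∀ W ∈ gradLp (P := P) hd, ⟪A b, W⟫ = 0 := by
    rintro b W ⟨w, hw, hW⟩
    rw [L2.inner_def, ← integral_inner_weakGrad_eq_zero hd (DivFree_const b) hw]
    refine integral_congr_ae ?_
    filter_upwards [hW, Lp.coeFn_const (p := 2) (μ := P) b] with ω h1 h2
    rw [h1, show A b = Lp.const 2 P b from rfl, h2]
    rfl
  have hL : ∀ b : Space d, b ≠ 0 → ∃ ζ ∈ Sᗮ, ⟪ζ, (hf.sqrtMul.comp A) b⟫ ≠ 0 := by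
    intro b hb
    -- The witness is `b/√f`: gradients have mean zero, so it lies in `Sᗮ`, and its pairing with `√f
    -- b` is `|b|²`.
    refine ⟨hf.sqrtDiv (A b), ?_, ?_⟩
    · rw [Submodule.mem_orthogonal']
      rintro _ ⟨W, hW, rfl⟩
      exact (hf.inner_sqrtDiv_sqrtMul _ _).trans (hconst b W hW)
    · have hb' : ∫ ω, A b ω ∂P = b := by
        rw [show A b = Lp.const 2 P b from rfl, integral_congr_ae (Lp.coeFn_const (p := 2) (μ := P) b)]
        simp
      rw [ContinuousLinearMap.comp_apply, hf.inner_sqrtDiv_sqrtMul]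
      rw [show ⟪A b, A b⟫ = ⟪∫ ω, A b ω ∂P, b⟫ from inner_constL _ _, hb']
      exact (real_inner_self_pos.2 hb).ne'
  obtain ⟨b, r, hr, hmean, hcl⟩ := exists_dual_minimiser S (hf.sqrtMul.comp A) hL y
  have hself : ∀ F G : Lp (Space d) 2 P, ⟪hf.sqrtMul F, G⟫ = ⟪F, hf.sqrtMul G⟫ :=
    fun F G => inner_mulLp _ _ F G
  have hFcl : hf.sqrtMul r ∈ (divFreeLp (P := P) hd).topologicalClosure := by
    refine mem_closure_divFreeLp hd _ fun w hw => ?_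
    have hW : ((memLp_weakGrad hd hw).toLp _ : Lp (Space d) 2 P) =ᵐ[P] weakGrad d P w :=
      MemLp.coeFn_toLp _
    have h1 : ⟪hf.sqrtMul r, ((memLp_weakGrad hd hw).toLp _ : Lp (Space d) 2 P)⟫ = 0 := by
      rw [hself]
      exact (Submodule.mem_orthogonal' _ _).1 hr _ ⟨_, ⟨w, hw, hW⟩, rfl⟩
    rw [L2.inner_def] at h1
    rw [← h1]
    refine integral_congr_ae ?_
    filter_upwards [hW] with ω h2
    rw [h2]
  have hFy : ∫ ω, hf.sqrtMul r ω ∂P = y := by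
    refine ext_inner_right ℝ fun a => ?_
    rw [← inner_constL, hself, ← hmean a]
    rfl
  have hm := minEnergy_le_norm_sq hd hf hFcl hFy
  rw [hf.sqrtDiv_sqrtMul] at hm
  -- `r` is orthogonal to `√f b - r`. Since `‖r‖²` also bounds both the minimal energy and `H(b,
  -- f)`, the quotient for direction `b` is at least `‖r‖²`.
  have hr2 : ⟪y, b⟫ = ‖r‖ ^ 2 := by
    rw [← hmean b, ← real_inner_self_eq_norm_sq r, ← sub_eq_zero, ← inner_sub_right]
    rw [← Submodule.orthogonal_closure] at hr
    exact (Submodule.mem_orthogonal' _ _).1 hr _ hcl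
  have hb : b ≠ 0 := by
    rintro rfl
    rw [inner_zero_right] at hr2
    have hr0 : r = 0 := by
      rw [← norm_eq_zero]
      exact pow_eq_zero_iff two_ne_zero |>.1 hr2.symm
    have := hmean y
    rw [hr0, inner_zero_left] at this
    exact hy (inner_self_eq_zero.1 this.symm)
  have hbn : 0 < ‖b‖ := norm_pos_iff.2 hb
  set η : Space d := ‖b‖⁻¹ • b with hη
  have hηn : ‖η‖ = 1 := norm_smul_inv_norm hb
  have hη0 : η ≠ 0 := by
    rw [← norm_ne_zero_iff, hηn]
    exact one_ne_zero
  refine ⟨⟨η, by simpa using hηn⟩, hm.trans ?_⟩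
  rw [le_div_iff₀ (H_pos hd hD hf hη0)]
  have hH : H P D (fun _ => η) f ≤ ‖‖b‖⁻¹ • r‖ ^ 2 := by
    have h1 := H_le_norm_sq hd hD hf η (S.topologicalClosure.smul_mem ‖b‖⁻¹ hcl)
    have h2 : hf.sqrtMul (Lp.constL 2 P ℝ η) - ‖b‖⁻¹ • ((hf.sqrtMul.comp A) b - r) =
        ‖b‖⁻¹ • r := by
      rw [hη, ← hA, map_smul, map_smul, smul_sub]
      simp
    rwa [h2] at h1
  refine (mul_le_mul_of_nonneg_left hH (sq_nonneg _)).trans (le_of_eq ?_)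
  have hi : ⟪y, η⟫ = ‖b‖⁻¹ * ‖r‖ ^ 2 := by rw [hη, real_inner_smul_right, hr2]
  change _ = ⟪y, η⟫ ^ 2
  rw [hi, norm_smul, norm_inv, norm_norm]
  ring

end Duality

/-! ### Convergence of integrals -/

section Convergence

variable {Ω : Type*} [MeasurableSpace Ω] {P : Measure Ω} [IsProbabilityMeasure P]

lemma tendsto_eLpNorm_two_zero_of_bounded {h : ℕ → Ω → ℝ} (hm : ∀ n, Measurable (h n)) {B : ℝ}
    (hB : ∀ n, ∀ᵐ ω ∂P, |h n ω| ≤ B) (h0 : ∀ᵐ ω ∂P, Tendsto (fun n => h n ω) atTop (𝓝 0)) :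
    Tendsto (fun n => eLpNorm (h n) 2 P) atTop (𝓝 0) := by
  have h1 : Tendsto (fun n => ∫⁻ ω, ‖h n ω‖ₑ ^ (2 : ℝ) ∂P) atTop (𝓝 (∫⁻ _, 0 ∂P)) := by
    refine tendsto_lintegral_of_dominated_convergence (fun _ => ENNReal.ofReal B ^ (2 : ℝ))
      (fun n => (hm n).enorm.pow_const _) (fun n => ?_) ?_ ?_
    · filter_upwards [hB n] with ω hω
      refine ENNReal.rpow_le_rpow ?_ zero_le_two
      rw [← ofReal_norm]
      exact ENNReal.ofReal_le_ofReal hω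
    · simp
    · filter_upwards [h0] with ω hω
      have h2 : Tendsto (fun n => ‖h n ω‖ₑ) atTop (𝓝 0) := by
        simpa using hω.enorm
      have h3 := ((ENNReal.continuous_rpow_const (y := 2)).tendsto 0).comp h2
      rw [ENNReal.zero_rpow_of_pos two_pos] at h3
      exact h3
  have h4 := ((ENNReal.continuous_rpow_const (y := 1 / 2)).tendsto _).comp h1
  simp only [lintegral_zero] at h4
  rw [ENNReal.zero_rpow_of_pos (by norm_num)] at h4
  refine h4.congr fun n => ?_
  rw [eLpNorm_eq_lintegral_rpow_enorm_toReal two_ne_zero ENNReal.ofNat_ne_top]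
  simp

lemma tendsto_integral_mul_zero {g h : ℕ → Ω → ℝ} (hg : ∀ n, AEStronglyMeasurable (g n) P)
    (hh : ∀ n, AEStronglyMeasurable (h n) P) (hg0 : Tendsto (fun n => eLpNorm (g n) 2 P) atTop (𝓝 0))
    {L : ℝ≥0∞} (hL : L ≠ ∞) (hh0 : Tendsto (fun n => eLpNorm (h n) 2 P) atTop (𝓝 L)) :
    Tendsto (fun n => ∫ ω, g n ω * h n ω ∂P) atTop (𝓝 0) := by
  rw [tendsto_zero_iff_norm_tendsto_zero]
  have h1 : Tendsto (fun n => (eLpNorm (g n) 2 P * eLpNorm (h n) 2 P)) atTop (𝓝 0) := by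
    have := ENNReal.Tendsto.mul hg0 (Or.inr hL) hh0 (Or.inr ENNReal.zero_ne_top)
    simpa using this
  have h2 : Tendsto (fun n => ‖∫ ω, g n ω * h n ω ∂P‖ₑ) atTop (𝓝 0) := by
    refine tendsto_of_tendsto_of_tendsto_of_le_of_le tendsto_const_nhds h1 (fun _ => zero_le)
      fun n => ?_
    refine (enorm_integral_le_lintegral_enorm _).trans ?_
    have h3 := eLpNorm_smul_le_mul_eLpNorm (𝕜 := ℝ) (p := 2) (q := 2) (r := 1) (hh n) (hg n)
    rw [eLpNorm_one_eq_lintegral_enorm] at h3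
    exact h3
  have h3 := (ENNReal.tendsto_toReal ENNReal.zero_ne_top).comp h2
  rw [ENNReal.toReal_zero] at h3
  exact h3.congr fun n => toReal_enorm _

lemma tendsto_integral_of_abs_sub_le {X E : ℕ → Ω → ℝ} {Y : Ω → ℝ}
    (hX : ∀ n, Integrable (X n) P) (hY : Integrable Y P) (hE : ∀ n, Integrable (E n) P)
    (h : ∀ n, ∀ᵐ ω ∂P, |X n ω - Y ω| ≤ E n ω)
    (h0 : Tendsto (fun n => ∫ ω, E n ω ∂P) atTop (𝓝 0)) :
    Tendsto (fun n => ∫ ω, X n ω ∂P) atTop (𝓝 (∫ ω, Y ω ∂P)) := by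
  rw [tendsto_iff_norm_sub_tendsto_zero]
  refine squeeze_zero (fun _ => norm_nonneg _) (fun n => ?_) h0
  rw [← integral_sub (hX n) hY]
  exact norm_integral_le_of_norm_le (hE n) (h n)

/-- The mollification lemmas ask for bounds at every `ω`, whereas `Fw` supplies only almost sure
ones. -/
lemma exists_bounded_version {g : Ω → ℝ} (hg : Measurable g) {M : ℝ} (hM : 0 ≤ M)
    (h : ∀ᵐ ω ∂P, |g ω| ≤ M) :
    ∃ g' : Ω → ℝ, Measurable g' ∧ (∀ ω, |g' ω| ≤ M) ∧ g =ᵐ[P] g' := by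
  refine ⟨{ω | |g ω| ≤ M}.indicator g, hg.indicator (measurableSet_le hg.abs measurable_const),
    fun ω => ?_, ?_⟩
  · by_cases h1 : |g ω| ≤ M <;> simp [Set.indicator, h1, hM]
  · filter_upwards [h] with ω hω
    simp [Set.indicator, hω]

/-- The right side is arranged so that each term is a product of two `L²`-small factors, or of an
`L²`-small factor and a constant. Only the limit gradient `q` is bounded by `M`; no uniform bound on
the approximating `p` is assumed. -/
lemma abs_sq_div_sub_le {p q a u f c M : ℝ} (hc : 0 < c) (hu : c ≤ u) (hf : c ≤ f) (hp : 0 ≤ p)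
    (hq : 0 ≤ q) (hqM : q ≤ M) (ha : |p - q| ≤ a) :
    |p ^ 2 / (8 * u) - q ^ 2 / (8 * f)| ≤
      (a * a + 2 * M * a) / (8 * c) + M ^ 2 * |u - f| / (8 * c ^ 2) := by
  have hu0 : 0 < u := hc.trans_le hu
  have hf0 : 0 < f := hc.trans_le hf
  have ha0 : 0 ≤ a := (abs_nonneg _).trans ha
  have e : p ^ 2 / (8 * u) - q ^ 2 / (8 * f) =
      (p ^ 2 - q ^ 2) / (8 * u) + q ^ 2 * (f - u) / (8 * (u * f)) := by
    field_simp
    ring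
  rw [e]
  refine (abs_add_le _ _).trans (add_le_add ?_ ?_)
  · rw [abs_div, abs_of_pos (by positivity : 0 < 8 * u)]
    have h1 : |p ^ 2 - q ^ 2| ≤ a * a + 2 * M * a := by
      have h2 : p ^ 2 - q ^ 2 = (p - q) * (p + q) := by ring
      rw [h2, abs_mul, abs_of_nonneg (by positivity : 0 ≤ p + q)]
      have h3 : p + q ≤ a + 2 * M := by linarith [(abs_le.1 ha).2]
      calc |p - q| * (p + q) ≤ a * (a + 2 * M) := by gcongr
        _ = a * a + 2 * M * a := by ring
    gcongr
    exact (abs_nonneg _).trans h1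
  · rw [abs_div, abs_of_pos (by positivity : 0 < 8 * (u * f)), abs_mul, abs_of_nonneg (sq_nonneg q),
      abs_sub_comm f u]
    have h4 : c ^ 2 ≤ u * f := by
      rw [sq]
      exact mul_le_mul hu hf hc.le hu0.le
    gcongr

lemma abs_div_sub_div_le {p u f c B : ℝ} (hc : 0 < c) (hu : c ≤ u) (hf : c ≤ f) (hp : 0 ≤ p)
    (hpB : p ≤ B) : |p / u - p / f| ≤ B / c ^ 2 * |u - f| := by
  have hu0 : 0 < u := hc.trans_le hu
  have hf0 : 0 < f := hc.trans_le hf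
  have e : p / u - p / f = p * (f - u) / (u * f) := by
    field_simp
  have h4 : c ^ 2 ≤ u * f := by
    rw [sq]
    exact mul_le_mul hu hf hc.le hu0.le
  rw [e, abs_div, abs_of_pos (by positivity : 0 < u * f), abs_mul, abs_of_nonneg hp,
    abs_sub_comm f u, div_mul_eq_mul_div]
  gcongr
  exact mul_nonneg (hp.trans hpB) (abs_nonneg _)

end Convergence

/-! ### Densities -/

section Densities

variable {Ω : Type*} [MeasurableSpace Ω] {d : ℕ} [AddAction (Space d) Ω]
  [MeasurableVAdd₂ (Space d) Ω] {P : Measure Ω} [IsProbabilityMeasure P]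
  [VAddInvariantMeasure (Space d) Ω P]

lemma ae_norm_le_toReal_eLpNorm_top {E : Type*} [NormedAddCommGroup E] {f : Ω → E}
    (h : eLpNorm f ∞ P < ∞) : ∀ᵐ ω ∂P, ‖f ω‖ ≤ (eLpNorm f ∞ P).toReal := by
  rw [eLpNorm_exponent_top] at h ⊢
  filter_upwards [ae_le_eLpNormEssSup (f := f) (μ := P)] with ω hω
  rw [← toReal_enorm]
  exact ENNReal.toReal_mono h.ne hω

lemma Fw_bounds (hd : 1 ≤ d) {f : Ω → ℝ} (hf : f ∈ Fw d P) : ∃ c C M : ℝ, IsWeight P f c C ∧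
    0 ≤ M ∧ (∀ᵐ ω ∂P, ‖weakGrad d P f ω‖ ≤ M) := by
  obtain ⟨hD, -, ⟨c, hc, hcf⟩, hC, hM⟩ := hf
  refine ⟨c, (eLpNorm f ∞ P).toReal, _, ⟨((mem_Dw_iff hd).1 hD).1, hc, hcf, ?_⟩, ENNReal.toReal_nonneg,
    ae_norm_le_toReal_eLpNorm_top hM⟩
  filter_upwards [ae_norm_le_toReal_eLpNorm_top hC] with ω hω
  exact (le_abs_self _).trans hω

lemma Fs_subset_Fw (hd : 1 ≤ d) : Fs (Ω := Ω) d P ⊆ Fw d P := by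
  rintro f ⟨hf, h1, c, hc, hcf⟩
  have hm := measurable_of_mem_Ds hd hf
  obtain ⟨C, hC⟩ := hf.2.exists_bound
  obtain ⟨C', hC'⟩ := hf.2.exists_bound_cpd
  refine ⟨hf.1, h1, ⟨c, hc, ae_of_all _ hcf⟩, (memLp_of_abs_le hm hC ∞).2, ?_⟩
  refine (memLp_of_components fun i => ?_).2
  exact (memLp_of_abs_le (measurable_cpd hm hf.2 i) (hC' i) ∞).ae_eq
    (isWeakPartial_cpd hm hf.2 i).weakPartial_ae_eq.symm

lemma one_mem_Fs : (fun _ : Ω => (1 : ℝ)) ∈ Fs d P :=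
  ⟨Ds_const 1, by simp, 1 / 2, by norm_num, fun _ => by norm_num⟩

lemma IsWeakPartial.congr_right {i : Fin d} {f g g' : Ω → ℝ} (h : IsWeakPartial P i f g)
    (hg' : Measurable g') (e : g =ᵐ[P] g') : IsWeakPartial P i f g' := by
  refine ⟨hg', ?_⟩
  filter_upwards [h.2, ae_ae_vadd (d := d) e] with ω h1 h2
  have h2 : realisation d g ω =ᵐ[volume] realisation d g' ω := h2
  refine ⟨h1.1, h1.2.1.congr h2, fun φ hφ hc => ?_⟩
  rw [h1.2.2 φ hφ hc]
  congr 1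
  refine integral_congr_ae ?_
  filter_upwards [h2] with x hx
  rw [hx]

/-- Mollification commutes with weak differentiation. -/
lemma IsWeakPartial.conv_pd_ae_eq {i : Fin d} {f g : Ω → ℝ} (h : IsWeakPartial P i f g)
    {ρ : Space d → ℝ} (hρ : IsTest ρ) : conv (pd i ρ) f =ᵐ[P] conv ρ g := by
  filter_upwards [h.2] with ω hω
  have h1 := hω.2.2 (fun x => ρ (-x)) hρ.comp_neg.smooth hρ.comp_neg.compact
  have h2 : ∀ x, fderiv ℝ (fun x => ρ (-x)) x (unitVec i) = -pd i ρ (-x) := fun x =>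
    congrFun (pd_comp_neg i hρ) x
  simp_rw [h2, mul_neg] at h1
  rw [integral_neg, neg_inj] at h1
  simp only [conv]
  rw [← integral_neg_eq_self (fun x : Space d => pd i ρ x * f (-x +ᵥ ω)),
    ← integral_neg_eq_self (fun x : Space d => ρ x * g (-x +ᵥ ω))]
  simp only [neg_neg]
  simp only [realisation] at h1
  simpa only [mul_comm] using h1

lemma le_conv_of_le {ρ : Space d → ℝ} (hρ : IsTest ρ) (h0 : ∀ x, 0 ≤ ρ x) (h1 : ∫ x, ρ x = 1)
    {u : Ω → ℝ} (hu : Measurable u) {C : ℝ} (hC : ∀ ω, |u ω| ≤ C) {c : ℝ} (hc : ∀ ω, c ≤ u ω)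
    (ω : Ω) : c ≤ conv ρ u ω := by
  have e : c = ∫ x, ρ x * c := by rw [integral_mul_const, h1, one_mul]
  rw [e, conv]
  refine integral_mono (hρ.integrable.mul_const c) ?_ fun x => mul_le_mul_of_nonneg_left (hc _) (h0 x)
  exact hρ.integrable.mul_bdd (c := C)
    (hu.comp (measurable_neg.vadd measurable_const)).aestronglyMeasurable (ae_of_all _ fun x => hC _)

lemma abs_conv_mollifier_le (n : ℕ) {u : Ω → ℝ} {C : ℝ} (hC : ∀ ω, |u ω| ≤ C) (ω : Ω) :
    |conv (mollifier d n) u ω| ≤ C := by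
  have h := abs_conv_le (isTest_mollifier (d := d) n).integrable hC ω
  simp_rw [abs_of_nonneg (mollifier_nonneg n _)] at h
  rwa [integral_mollifier, one_mul] at h

lemma tendsto_eLpNorm_conv_mollifier_sub {u : Ω → ℝ} (hu : Measurable u) {C : ℝ}
    (hC : ∀ ω, |u ω| ≤ C) :
    Tendsto (fun n => eLpNorm (conv (mollifier d n) u - u) 2 P) atTop (𝓝 0) := by
  refine tendsto_eLpNorm_two_zero_of_bounded (B := C + C)
    (fun n => (measurable_conv (isTest_mollifier n).continuous.measurable hu).sub hu)
    (fun n => ae_of_all _ fun ω => ?_) ?_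
  · exact (abs_sub _ _).trans (add_le_add (abs_conv_mollifier_le n hC ω) (hC ω))
  · filter_upwards [ae_tendsto_conv_mollifier (d := d) (P := P) hu
      ((memLp_of_abs_le hu hC 1).integrable le_rfl)] with ω hω
    simpa using hω.sub_const (u ω)

/-- The smooth densities approximate all weakly differentiable densities. -/
lemma Fs_mem_DensityClass (hd : 1 ≤ d) : Fs (Ω := Ω) d P ∈ DensityClass d P := by
  refine ⟨Fs_subset_Fw hd, fun f hf => ?_⟩
  obtain ⟨c, C, M, hw, hM, hgrad⟩ := Fw_bounds hd hf
  have hfD := (mem_Dw_iff hd).1 hf.1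
  -- Clipping between the essential bounds gives a version bounded everywhere, so its mollifications
  -- lie in `Ds`.
  set f' : Ω → ℝ := fun ω => max c (min C (f ω)) with hf'
  have hf'm : Measurable f' := measurable_const.max (measurable_const.min hw.measurable)
  have hff' : f =ᵐ[P] f' := by
    filter_upwards [hw.lower, hw.upper] with ω h1 h2
    rw [hf']
    dsimp only
    rw [min_eq_right h2, max_eq_right h1.le]
  have hf'c : ∀ ω, c ≤ f' ω := fun ω => le_max_left _ _
  have hf'b : ∀ ω, |f' ω| ≤ max c C := fun ω => by
    rw [abs_of_nonneg (hw.pos.le.trans (hf'c ω))]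
    exact max_le_max le_rfl (min_le_left _ _)
  have hgi : ∀ i : Fin d, ∀ᵐ ω ∂P, |weakPartial P i f ω| ≤ M := fun i => by
    filter_upwards [hgrad] with ω hω
    exact (PiLp.norm_apply_le (weakGrad d P f ω) i).trans hω
  choose g hgm hgb hge using fun i : Fin d =>
    exists_bounded_version (measurable_weakPartial (P := P) i f) hM (hgi i)
  have hwp : ∀ i, IsWeakPartial P i f' (g i) := fun i =>
    ((hfD.2.2 i).1.congr hff').congr_right (hgm i) (hge i)
  set u : ℕ → Ω → ℝ := fun n => conv (mollifier d n) f' with hu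
  have hum : ∀ n, Measurable (u n) := fun n =>
    measurable_conv (isTest_mollifier n).continuous.measurable hf'm
  have hus : ∀ n, IsSmoothBounded d (u n) := fun n =>
    isSmoothBounded_conv (isTest_mollifier n) hf'm hf'b
  have huc : ∀ n ω, c ≤ u n ω := fun n =>
    le_conv_of_le (isTest_mollifier n) (mollifier_nonneg n) (integral_mollifier n) hf'm hf'b hf'c
  -- Averaging keeps only the weak bound `c ≤ u n`; halving `c` restores the strict one.
  have hlt : c / 2 < c := half_lt_self hw.pos
  refine ⟨u, c / 2, fun n => ⟨mem_Ds (hum n) (hus n), ?_, c / 2, half_pos hw.pos,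
    fun ω => hlt.trans_le (huc n ω)⟩, half_pos hw.pos, ?_,
    ae_of_all _ fun ω n => hlt.trans_le (huc n ω)⟩
  · rw [hu]
    dsimp only
    rw [integral_conv (isTest_mollifier n).integrable
      ((memLp_of_abs_le hf'm hf'b 1).integrable le_rfl), integral_mollifier, one_mul,
      ← integral_congr_ae hff']
    exact hf.2.1
  · have h1 : ∀ n, eLpNorm (u n - f) 2 P = eLpNorm (conv (mollifier d n) f' - f') 2 P := fun n =>
      eLpNorm_congr_ae ((EventuallyEq.refl _ _).sub hff')
    have h2 : ∀ n (i : Fin d), eLpNorm (weakPartial P i (u n - f)) 2 P =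
        eLpNorm (conv (mollifier d n) (g i) - g i) 2 P := by
      intro n i
      refine eLpNorm_congr_ae ?_
      have h3 : IsWeakPartial P i (u n - f) (cpd i (u n) + (-1 : ℝ) • g i) := by
        have h4 := (isWeakPartial_cpd (P := P) (hum n) (hus n) i).add ((hwp i).smul (-1))
        refine h4.congr ?_
        filter_upwards [hff'] with ω hω
        simp [hω, sub_eq_add_neg]
      refine h3.weakPartial_ae_eq.trans ?_
      have h5 := (hwp i).conv_pd_ae_eq (isTest_mollifier (d := d) n)
      filter_upwards [h5] with ω hω
      simp only [hu, cpd_conv (isTest_mollifier n) hf'm hf'b, Pi.add_apply, Pi.smul_apply,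
        Pi.sub_apply, smul_eq_mul, hω]
      ring
    simp only [nablaNorm, h1, h2]
    have h6 := (tendsto_eLpNorm_conv_mollifier_sub (d := d) (P := P) hf'm hf'b).add
      (tendsto_finsetSum Finset.univ fun i _ =>
        tendsto_eLpNorm_conv_mollifier_sub (d := d) (P := P) (hgm i) (hgb i))
    simpa using h6

end Densities

/-! ### The variational formulas -/

section Main

variable {Ω : Type*} [MeasurableSpace Ω] {d : ℕ} [AddAction (Space d) Ω]
  [MeasurableVAdd₂ (Space d) Ω] {P : Measure Ω} [IsProbabilityMeasure P]
  [VAddInvariantMeasure (Space d) Ω P] {V : Ω → ℝ}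

lemma K_nonneg (hV : IsPotential P V) {f : Ω → ℝ} {c C : ℝ} (hf : IsWeight P f c C) :
    0 ≤ K d P V f := by
  refine integral_nonneg_of_ae ?_
  filter_upwards [hf.lower] with ω hω
  have hfp := hf.pos.trans hω
  exact add_nonneg (by positivity) (mul_nonneg (hV.nonneg ω) hfp.le)

/-- Weak duality bounds every term, and an optimal direction attains the bound. The real-valued
supremum is therefore over a bounded family and carries no junk value. -/
lemma iSup_sqrt_eq (hd : 1 ≤ d) (hV : IsPotential P V) {D : Set (Ω → ℝ)}
    (hD : D ∈ TestClass d P) {f : Ω → ℝ} {c C : ℝ} (hf : IsWeight P f c C) (y : Space d) :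
    ⨆ η : Metric.sphere (0 : Space d) 1,
      √(2 * K d P V f * (⟪y, (η : Space d)⟫ ^ 2 / H P D (fun _ => (η : Space d)) f)) =
    √(2 * K d P V f * minEnergy P y f) := by
  have hK : 0 ≤ 2 * K d P V f := mul_nonneg zero_le_two (K_nonneg hV hf)
  have hle : ∀ η : Metric.sphere (0 : Space d) 1,
      √(2 * K d P V f * (⟪y, (η : Space d)⟫ ^ 2 / H P D (fun _ => (η : Space d)) f)) ≤
        √(2 * K d P V f * minEnergy P y f) := fun η =>
    Real.sqrt_le_sqrt (mul_le_mul_of_nonneg_left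
      (div_H_le_minEnergy hd hD hf y (ne_zero_of_mem_unit_sphere η)) hK)
  obtain ⟨η, hη⟩ := exists_minEnergy_le_div_H hd hD hf y
  have : Nonempty (Metric.sphere (0 : Space d) 1) := ⟨η⟩
  refine le_antisymm (ciSup_le hle) ?_
  refine le_ciSup_of_le ⟨√(2 * K d P V f * minEnergy P y f), ?_⟩ η (Real.sqrt_le_sqrt (mul_le_mul_of_nonneg_left hη hK))
  rintro _ ⟨η, rfl⟩
  exact hle η

lemma infSup_eq (hd : 1 ≤ d) (hV : IsPotential P V) {D F : Set (Ω → ℝ)}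
    (hD : D ∈ TestClass d P) (hF : F ⊆ Fw d P) (y : Space d) :
    infSup P V D F y = ⨅ f : F, √(2 * K d P V f * minEnergy P y f) := by
  refine iInf_congr fun f => ?_
  obtain ⟨c, C, M, hw, -⟩ := Fw_bounds hd (hF f.2)
  exact iSup_sqrt_eq hd hV hD hw y

lemma Gam_eq (hd : 1 ≤ d) (y : Space d) :
    Gam P V y = ⨅ f : Fs (Ω := Ω) d P, √(2 * K d P V f * minEnergy P y f) := by
  rw [Gam, Real.mul_iInf_of_nonneg zero_le_two]
  refine iInf_congr fun f => ?_
  have hK : ∫ ω, (‖classicalGrad d f.1 ω‖ ^ 2 / (8 * f.1 ω) + V ω * f.1 ω) ∂P = K d P V f := by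
    refine integral_congr_ae ?_
    filter_upwards [weakGrad_ae_eq_classicalGrad (P := P) (measurable_of_mem_Ds hd f.2.1)
      f.2.1.2] with ω hω
    rw [hω]
  have hm : ⨅ φ : PhiS (Ω := Ω) P y, ∫ ω, ‖φ.1 ω‖ ^ 2 / (2 * f.1 ω) ∂P =
      2⁻¹ * minEnergy P y f := by
    rw [minEnergy, Real.mul_iInf_of_nonneg (by norm_num)]
    refine iInf_congr fun φ => ?_
    rw [← integral_const_mul]
    refine integral_congr_ae (ae_of_all _ fun ω => ?_)
    dsimp only
    rw [div_mul_eq_div_div, inv_mul_eq_div, div_right_comm]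
  rw [hK, hm]
  -- Moving the outer `2` under the root gives `4 · K · (1/2)`, that is the factor `2` in front of
  -- `K`.
  have h2 : (2 : ℝ) = √4 := by
    rw [show (4 : ℝ) = 2 ^ 2 by norm_num, Real.sqrt_sq zero_le_two]
  conv_lhs => rw [h2]
  rw [← Real.sqrt_mul (by norm_num)]
  congr 1
  ring

lemma memLp_of_mem_Fw (hd : 1 ≤ d) {f : Ω → ℝ} (hf : f ∈ Fw d P) : MemLp f 2 P :=
  ((mem_Dw_iff hd).1 hf.1).2.1

lemma integrable_div_weight {f : Ω → ℝ} {c C : ℝ} (hf : IsWeight P f c C) {g : Ω → ℝ}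
    (hg : Integrable g P) : Integrable (fun ω => g ω / f ω) P := by
  simp_rw [div_eq_mul_inv]
  refine hg.mul_bdd (c := c⁻¹) hf.measurable.inv.aestronglyMeasurable ?_
  filter_upwards [hf.lower] with ω hω
  rw [norm_inv, Real.norm_eq_abs, abs_of_pos (hf.pos.trans hω)]
  exact inv_anti₀ hf.pos hω.le

lemma integrable_K (hd : 1 ≤ d) (hV2 : MemLp V 2 P) {f : Ω → ℝ} (hf : f ∈ Fw d P) :
    Integrable (fun ω => ‖weakGrad d P f ω‖ ^ 2 / (8 * f ω) + V ω * f ω) P := by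
  obtain ⟨c, C, M, hw, -⟩ := Fw_bounds hd hf
  refine Integrable.add ?_ (hV2.integrable_mul (memLp_of_mem_Fw hd hf))
  have h1 := integrable_div_weight hw
    (((memLp_weakGrad hd hf.1).integrable_norm_pow two_ne_zero).div_const 8)
  refine h1.congr (ae_of_all _ fun ω => ?_)
  dsimp only
  rw [div_div]

/-! ### Continuity of the functionals along approximating densities. -/

section Approximation

variable {u : ℕ → Ω → ℝ} {f : Ω → ℝ} {c : ℝ}

lemma tendsto_eLpNorm_abs_sub
    (hlim : Tendsto (fun n => nablaNorm d P (u n - f)) atTop (𝓝 0)) :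
    Tendsto (fun n => eLpNorm (fun ω => |u n ω - f ω|) 2 P) atTop (𝓝 0) := by
  refine tendsto_of_tendsto_of_tendsto_of_le_of_le tendsto_const_nhds hlim (fun _ => zero_le)
    fun n => ?_
  have : eLpNorm (fun ω => |u n ω - f ω|) 2 P = eLpNorm (u n - f) 2 P := eLpNorm_norm (u n - f)
  dsimp only
  rw [this]
  exact le_self_add

lemma tendsto_eLpNorm_norm_weakGrad_sub (hd : 1 ≤ d) (hu : ∀ n, u n ∈ Dw d P) (hf : f ∈ Dw d P)
    (hlim : Tendsto (fun n => nablaNorm d P (u n - f)) atTop (𝓝 0)) :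
    Tendsto (fun n => eLpNorm (fun ω => ‖weakGrad d P (u n) ω - weakGrad d P f ω‖) 2 P) atTop
      (𝓝 0) := by
  refine tendsto_of_tendsto_of_tendsto_of_le_of_le tendsto_const_nhds hlim (fun _ => zero_le)
    fun n => ?_
  refine le_trans (le_of_eq ?_) (eLpNorm_weakGrad_le (u n - f))
  rw [eLpNorm_congr_ae (weakGrad_sub hd (hu n) hf)]
  exact eLpNorm_norm _

/-- The energy of a fixed bounded field is continuous in the density. -/
lemma tendsto_energy (hd : 1 ≤ d) (hu : ∀ n, u n ∈ Fw d P) (hf : f ∈ Fw d P) (hc : 0 < c)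
    (hcu : ∀ n, ∀ᵐ ω ∂P, c ≤ u n ω) (hcf : ∀ᵐ ω ∂P, c ≤ f ω)
    (hlim : Tendsto (fun n => nablaNorm d P (u n - f)) atTop (𝓝 0)) {φ : Ω → Space d}
    (hφ : φ ∈ DivFree d P) :
    Tendsto (fun n => ∫ ω, ‖φ ω‖ ^ 2 / u n ω ∂P) atTop (𝓝 (∫ ω, ‖φ ω‖ ^ 2 / f ω ∂P)) := by
  have hb2 : ∀ n, MemLp (fun ω => |u n ω - f ω|) 2 P := fun n =>
    ((memLp_of_mem_Fw hd (hu n)).sub (memLp_of_mem_Fw hd hf)).norm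
  have hφ2 : Integrable (fun ω => ‖φ ω‖ ^ 2) P :=
    (memLp_of_mem_DivFree hd hφ 2).integrable_norm_pow two_ne_zero
  have hint : ∀ {g : Ω → ℝ}, g ∈ Fw d P → Integrable (fun ω => ‖φ ω‖ ^ 2 / g ω) P := by
    intro g hg
    obtain ⟨c, C, M, hw, -⟩ := Fw_bounds hd hg
    exact integrable_div_weight hw hφ2
  have hbd := ae_norm_le_toReal_eLpNorm_top (memLp_of_mem_DivFree hd hφ ∞).2
  set B := (eLpNorm φ ∞ P).toReal
  refine tendsto_integral_of_abs_sub_le (E := fun n ω => B ^ 2 / c ^ 2 * |u n ω - f ω|)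
    (fun n => hint (hu n)) (hint hf) (fun n => ((hb2 n).integrable one_le_two).const_mul _)
    (fun n => ?_) ?_
  · filter_upwards [hcu n, hcf, hbd] with ω h1 h2 h3
    exact abs_div_sub_div_le hc h1 h2 (sq_nonneg _) (pow_le_pow_left₀ (norm_nonneg _) h3 2)
  · have h1 := tendsto_integral_mul_zero (P := P) (g := fun n ω => |u n ω - f ω|)
      (h := fun _ _ => (B ^ 2 / c ^ 2 : ℝ)) (fun n => (hb2 n).1)
      (fun _ => aestronglyMeasurable_const) (tendsto_eLpNorm_abs_sub (d := d) hlim)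
      (memLp_const (B ^ 2 / c ^ 2 : ℝ)).2.ne tendsto_const_nhds
    simpa only [mul_comm] using h1

/-- Continuity of `K` along approximating densities. -/
lemma tendsto_K (hd : 1 ≤ d) (hV2 : MemLp V 2 P) (hu : ∀ n, u n ∈ Fw d P) (hf : f ∈ Fw d P)
    (hc : 0 < c) (hcu : ∀ n, ∀ᵐ ω ∂P, c ≤ u n ω) (hcf : ∀ᵐ ω ∂P, c ≤ f ω)
    (hlim : Tendsto (fun n => nablaNorm d P (u n - f)) atTop (𝓝 0)) :
    Tendsto (fun n => K d P V (u n)) atTop (𝓝 (K d P V f)) := by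
  obtain ⟨-, -, M, -, hM, hgrad⟩ := Fw_bounds hd hf
  have hb2 : ∀ n, MemLp (fun ω => |u n ω - f ω|) 2 P := fun n =>
    ((memLp_of_mem_Fw hd (hu n)).sub (memLp_of_mem_Fw hd hf)).norm
  have ha2 : ∀ n, MemLp (fun ω => ‖weakGrad d P (u n) ω - weakGrad d P f ω‖) 2 P := fun n =>
    ((memLp_weakGrad hd (hu n).1).sub (memLp_weakGrad hd hf.1)).norm
  have hb0 := tendsto_eLpNorm_abs_sub (P := P) (d := d) hlim
  have ha0 := tendsto_eLpNorm_norm_weakGrad_sub hd (fun n => (hu n).1) hf.1 hlim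
  set a : ℕ → Ω → ℝ := fun n ω => ‖weakGrad d P (u n) ω - weakGrad d P f ω‖ with ha
  set b : ℕ → Ω → ℝ := fun n ω => |u n ω - f ω| with hb
  have i1 : ∀ n, Integrable (fun ω => a n ω * a n ω) P := fun n => (ha2 n).integrable_mul (ha2 n)
  have i2 : ∀ n, Integrable (fun ω => a n ω * (2 * M)) P := fun n =>
    ((ha2 n).integrable one_le_two).mul_const _
  have i3 : ∀ n, Integrable (fun ω => b n ω * (M ^ 2 / (8 * c ^ 2))) P := fun n =>
    ((hb2 n).integrable one_le_two).mul_const _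
  have i4 : ∀ n, Integrable (fun ω => b n ω * |V ω|) P := fun n => (hb2 n).integrable_mul hV2.norm
  -- The error `E` collects the gradient term, the change of denominator and the potential term `|V|
  -- |u n - f|`. In the last, `V ∈ L²` is paired with `L²` convergence of the densities, which need
  -- not be uniformly bounded above.
  refine tendsto_integral_of_abs_sub_le
    (E := fun n ω => (a n ω * a n ω + a n ω * (2 * M)) / (8 * c) +
      b n ω * (M ^ 2 / (8 * c ^ 2)) + b n ω * |V ω|)
    (fun n => integrable_K hd hV2 (hu n)) (integrable_K hd hV2 hf)
    (fun n => ((((i1 n).add (i2 n)).div_const _).add (i3 n)).add (i4 n)) (fun n => ?_) ?_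
  · filter_upwards [hcu n, hcf, hgrad] with ω h1 h2 h3
    have h4 := abs_sq_div_sub_le hc h1 h2 (norm_nonneg (weakGrad d P (u n) ω))
      (norm_nonneg (weakGrad d P f ω)) h3 (abs_norm_sub_norm_le _ _)
    have h5 : |V ω * u n ω - V ω * f ω| = b n ω * |V ω| := by
      rw [← mul_sub, abs_mul, mul_comm]
    have e : ∀ p q r s : ℝ, p + q - (r + s) = (p - r) + (q - s) := fun p q r s => by ring
    rw [e]
    refine (abs_add_le _ _).trans (add_le_add (h4.trans (le_of_eq ?_)) h5.le)
    simp only [ha, hb]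
    ring
  · have l1 := tendsto_integral_mul_zero (P := P) (fun n => (ha2 n).1) (fun n => (ha2 n).1) ha0
      ENNReal.zero_ne_top ha0
    have l2 := tendsto_integral_mul_zero (P := P) (h := fun _ _ => 2 * M) (fun n => (ha2 n).1)
      (fun _ => aestronglyMeasurable_const) ha0 (memLp_const (2 * M)).2.ne tendsto_const_nhds
    have l3 := tendsto_integral_mul_zero (P := P) (h := fun _ _ => M ^ 2 / (8 * c ^ 2))
      (fun n => (hb2 n).1) (fun _ => aestronglyMeasurable_const) hb0
      (memLp_const (M ^ 2 / (8 * c ^ 2))).2.ne tendsto_const_nhds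
    have l4 := tendsto_integral_mul_zero (P := P) (h := fun _ ω => |V ω|)
      (fun n => (hb2 n).1) (fun _ => hV2.norm.1) hb0 hV2.norm.2.ne tendsto_const_nhds
    have l5 := (((l1.add l2).div_const (8 * c)).add l3).add l4
    simp only [add_zero, zero_div] at l5
    refine l5.congr fun n => ?_
    have e1 : ∫ ω, (a n ω * a n ω + a n ω * (2 * M)) / (8 * c) +
        b n ω * (M ^ 2 / (8 * c ^ 2)) + b n ω * |V ω| ∂P =
        ∫ ω, (a n ω * a n ω + a n ω * (2 * M)) / (8 * c) + b n ω * (M ^ 2 / (8 * c ^ 2)) ∂P +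
          ∫ ω, b n ω * |V ω| ∂P :=
      integral_add ((((i1 n).add (i2 n)).div_const _).add (i3 n)) (i4 n)
    have e2 : ∫ ω, (a n ω * a n ω + a n ω * (2 * M)) / (8 * c) +
        b n ω * (M ^ 2 / (8 * c ^ 2)) ∂P =
        ∫ ω, (a n ω * a n ω + a n ω * (2 * M)) / (8 * c) ∂P +
          ∫ ω, b n ω * (M ^ 2 / (8 * c ^ 2)) ∂P :=
      integral_add (((i1 n).add (i2 n)).div_const _) (i3 n)
    have e3 : ∫ ω, a n ω * a n ω + a n ω * (2 * M) ∂P =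
        ∫ ω, a n ω * a n ω ∂P + ∫ ω, a n ω * (2 * M) ∂P := integral_add (i1 n) (i2 n)
    rw [e1, e2, integral_div, e3]

end Approximation

/-- The infimum does not depend on the class of densities. -/
lemma iInf_eq_iInf_Fw (hd : 1 ≤ d) (hV : IsPotential P V) (hV2 : MemLp V 2 P)
    {F : Set (Ω → ℝ)} (hF : F ∈ DensityClass d P) (y : Space d) :
    ⨅ f : F, √(2 * K d P V f * minEnergy P y f) =
      ⨅ f : Fw (Ω := Ω) d P, √(2 * K d P V f * minEnergy P y f) := by
  have hFw1 : (fun _ : Ω => (1 : ℝ)) ∈ Fw d P := Fs_subset_Fw hd one_mem_Fs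
  have hneF : Nonempty F := by
    obtain ⟨u, c, hu, -⟩ := hF.2 _ hFw1
    exact ⟨_, hu 0⟩
  have hneFw : Nonempty (Fw (Ω := Ω) d P) := ⟨_, hFw1⟩
  have hbdd : ∀ G : Set (Ω → ℝ), BddBelow (Set.range fun f : G =>
      √(2 * K d P V f * minEnergy P y f)) := by
    intro G
    refine ⟨0, ?_⟩
    rintro _ ⟨f, rfl⟩
    exact Real.sqrt_nonneg _
  refine le_antisymm (le_ciInf fun f => ?_)
    (le_ciInf fun f => ciInf_le (hbdd _) ⟨f.1, hF.1 f.2⟩)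
  obtain ⟨f, hf⟩ := f
  set I := ⨅ f : F, √(2 * K d P V f * minEnergy P y f) with hI
  have hI0 : 0 ≤ I := Real.iInf_nonneg fun _ => Real.sqrt_nonneg _
  obtain ⟨u, c, huF, hc, hlim, hcu⟩ := hF.2 f hf
  have hu : ∀ n, u n ∈ Fw d P := fun n => hF.1 (huF n)
  obtain ⟨c', C', M, hw, -⟩ := Fw_bounds hd hf
  have hcu' : ∀ n, ∀ᵐ ω ∂P, min c c' ≤ u n ω := by
    intro n
    filter_upwards [hcu] with ω hω
    exact (min_le_left _ _).trans (hω n).le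
  have hcf' : ∀ᵐ ω ∂P, min c c' ≤ f ω := by
    filter_upwards [hw.lower] with ω hω
    exact (min_le_right _ _).trans hω.le
  have hc0 : 0 < min c c' := lt_min hc hw.pos
  have hKlim := tendsto_K hd hV2 hu hf hc0 hcu' hcf' hlim
  -- Pass to the limit with `φ` fixed and take the infimum over `φ` only afterwards. This uses just
  -- upper semicontinuity of the minimal energy, which suffices because `F ⊆ Fw` already gives the
  -- opposite inequality.
  have hφ : ∀ φ : PhiS (Ω := Ω) P y, I ^ 2 ≤ 2 * K d P V f * ∫ ω, ‖φ.1 ω‖ ^ 2 / f ω ∂P := by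
    intro φ
    have hJ := tendsto_energy hd hu hf hc0 hcu' hcf' hlim (mem_PhiS_iff.1 φ.2).1
    refine ge_of_tendsto' ((hKlim.const_mul 2).mul hJ) fun n => ?_
    obtain ⟨cn, Cn, -, hwn, -⟩ := Fw_bounds hd (hu n)
    have hKn : 0 ≤ 2 * K d P V (u n) := mul_nonneg zero_le_two (K_nonneg hV hwn)
    have h1 : I ≤ √(2 * K d P V (u n) * minEnergy P y (u n)) := ciInf_le (hbdd F) ⟨u n, huF n⟩
    have h2 : I ^ 2 ≤ 2 * K d P V (u n) * minEnergy P y (u n) :=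
      (Real.le_sqrt hI0 (mul_nonneg hKn (minEnergy_nonneg hwn y))).1 h1
    exact h2.trans (mul_le_mul_of_nonneg_left (ciInf_le (bddBelow_energy hwn y) φ) hKn)
  have hK : 0 ≤ 2 * K d P V f := mul_nonneg zero_le_two (K_nonneg hV hw)
  refine (Real.le_sqrt hI0 (mul_nonneg hK (minEnergy_nonneg hw y))).2 ?_
  have : Nonempty (PhiS (Ω := Ω) P y) := ⟨_, const_mem_PhiS y⟩
  rw [minEnergy, Real.mul_iInf_of_nonneg hK]
  exact le_ciInf hφ

end Main

end StationaryPotential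

end

theorem proposition3p11 {Ω : Type*} [MeasurableSpace Ω] (d : ℕ) (hd : 1 ≤ d)
    [AddAction (StationaryPotential.Space d) Ω]
    [MeasurableVAdd₂ (StationaryPotential.Space d) Ω]
    (P : Measure Ω) [IsProbabilityMeasure P]
    [VAddInvariantMeasure (StationaryPotential.Space d) Ω P]
    (V : Ω → ℝ) (hV : StationaryPotential.IsPotential P V)
    (y : StationaryPotential.Space d)
    (D : Set (Ω → ℝ)) (hD : D ∈ StationaryPotential.TestClass d P) :
    StationaryPotential.Gam P V y =
        StationaryPotential.infSup P V D (StationaryPotential.Fs d P) y ∧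
      (MemLp V 2 P → ∀ F ∈ StationaryPotential.DensityClass d P,
        StationaryPotential.Gam P V y = StationaryPotential.infSup P V D F y) := by
  open StationaryPotential in
  refine ⟨?_, fun hV2 F hF => ?_⟩
  · rw [Gam_eq hd, infSup_eq hd hV hD (Fs_subset_Fw hd)]
  -- Both `F` and `Fs` are admissible classes, so each infimum equals the one over `Fw`.
  · rw [Gam_eq hd, infSup_eq hd hV hD hF.1, iInf_eq_iInf_Fw hd hV hV2 hF,
      iInf_eq_iInf_Fw hd hV hV2 (Fs_mem_DensityClass hd)]
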